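/- Manifolds are smooth, finite-dimensional, Hausdorff and second countable; $\mathbb{R}^\times$ denotes either $\mathbb{R}\setminus\{0\}$ or $\mathbb{R}^+$. An action of a Lie group on a manifold $M$ is \emph{principal} if it is the action of a (locally trivial) smooth principal bundle with total space $M$; the base is then the orbit space. Let $(S,\omega)$ be a symplectic manifold and $H\in C^\infty(S)$. For $f\in C^\infty(S)$ let $X_f=X_f^\omega$ be the vector field with $i_{X_f}\omega=df$, and let $\{f,g\}_S=\omega(X_g,X_f)=X_f(g)$. Let $\phi:\mathbb{R}^\times\times S\to S$ be a scaling symmetry, i.e. a principal action with $\phi_s^*\omega=s\,\omega$ and $H\circ\phi_s=sH$ for all $s\in\mathbb{R}^\times$. Let $\Phi:G\times S\to S$ be the action of a Lie group $G$ of a principal $G$-bundle $\wp_S:S\to P=S/G$, with $\Phi_b^*\omega=\omega$ and $H\circ\Phi_b=H$ for all $b\in G$. Assume that $\Phi_b\circ\phi_s=\phi_s\circ\Phi_b$ for all $s,b$ and that the resulting action of $\mathbb{R}^\times\times G$ on $S$ is principal. Then: (1) There are a Poisson bracket $\{\cdot,\cdot\}_P$ on $P$ with $\{f_1,f_2\}_P\circ\wp_S=\{f_1\circ\wp_S,f_2\circ\wp_S\}_S$,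 a function $H^G\in C^\infty(P)$ with $H^G\circ\wp_S=H$, and an action $\phi^P$ of $\mathbb{R}^\times$ on $P$ with $\phi^P_s\circ\wp_S=\wp_S\circ\phi_s$. The action $\phi^P$ is principal, $\{F\circ\phi^P_s,F'\circ\phi^P_s\}_P=s\,\{F,F'\}_P\circ\phi^P_s$ for $F,F'\in C^\infty(P)$, and $H^G\circ\phi^P_s=sH^G$. Let ${\bf p}_P:P\to K=P/\mathbb{R}^\times$ be the corresponding principal bundle, $L=(P\times\mathbb{R})/\mathbb{R}^\times\to K$ its associated line bundle, where $s\cdot(y,t)=(\phi^P_s(y),t/s)$, and $\Gamma(L^*)$ the space of smooth sections of the dual bundle $L^*$. Every homogeneous function $F\in C^\infty(P)$ (i.e. $F\circ\phi^P_s=sF$), in particular $H^G$, induces a section $h_F\in\Gamma(L^*)$ by $h_F({\bf p}_P(y))([y,t])=t\,F(y)$. (2) There is a Kirillov bracket $[\cdot,\cdot]_{L^*}$ on $\Gamma(L^*)$, i.e. a Lie bracket such that for every $h_2\in\Gamma(L^*)$ there is a smooth vector field $X_{h_2}$ on $K$, the symbol of $[\cdot,h_2]_{L^*}$, with $[fh_1,h_2]_{L^*}=f[h_1,h_2]_{L^*}+X_{h_2}(f)h_1$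 for all $h_1\in\Gamma(L^*)$, $f\in C^\infty(K)$, and such that for all homogeneous $H_1,H_2\in C^\infty(P)$ the function $\{H_1,H_2\}_P$ is homogeneous and $[h_{H_1},h_{H_2}]_{L^*}=-h_{\{H_1,H_2\}_P}$. (3) For this bracket, the symbol of $[\cdot,h_{H^G}]_{L^*}$ is unique, the Hamiltonian vector field $X_H^\omega$ is $({\bf p}_P\circ\wp_S)$-projectable, and its projection on $K$ is this symbol: $T({\bf p}_P\circ\wp_S)\circ X_H^\omega=X_{h_{H^G}}\circ{\bf p}_P\circ\wp_S$. -/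

import Mathlib

open scoped Manifold ContDiff Topology

universe u

noncomputable section

/-! ## The multiplicative group of scalings

The scaling group is an open subgroup `Λ` of `ℝˣ`; in the theorem it is either all of `ℝˣ`
or the subgroup of positive units.  As an open subset of `ℝˣ` it is a one-dimensional manifold. -/

instance OpenSubgroup.instChartedSpaceUnitsReal (Λ : OpenSubgroup ℝˣ) : ChartedSpace ℝ Λ :=
  inferInstanceAs (ChartedSpace ℝ (Λ : TopologicalSpace.Opens ℝˣ))

/-- The real number underlying a scaling parameter. -/
def scal {Λ : OpenSubgroup ℝˣ} (s : Λ) : ℝ := ((s : ℝˣ) : ℝ)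

lemma scal_ne_zero {Λ : OpenSubgroup ℝˣ} (s : Λ) : scal s ≠ 0 := (s : ℝˣ).ne_zero

@[simp] lemma scal_one {Λ : OpenSubgroup ℝˣ} : scal (1 : Λ) = 1 := by simp [scal]

@[simp] lemma scal_mul {Λ : OpenSubgroup ℝˣ} (s t : Λ) : scal (s * t) = scal s * scal t := by
  simp [scal]

@[simp] lemma scal_inv {Λ : OpenSubgroup ℝˣ} (s : Λ) : scal s⁻¹ = (scal s)⁻¹ := by
  simp [scal]

/-! ## Smooth actions and principal bundles -/

section Principal

variable {EG HG EM HM EK HK : Type*}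
  [NormedAddCommGroup EG] [NormedSpace ℝ EG] [TopologicalSpace HG]
  [NormedAddCommGroup EM] [NormedSpace ℝ EM] [TopologicalSpace HM]
  [NormedAddCommGroup EK] [NormedSpace ℝ EK] [TopologicalSpace HK]
  {G M K : Type*} [Group G]
  [TopologicalSpace G] [ChartedSpace HG G]
  [TopologicalSpace M] [ChartedSpace HM M]
  [TopologicalSpace K] [ChartedSpace HK K]

/-- `a : G → M → M` is a smooth left action of `G` on the manifold `M`. -/
structure IsSmoothAction (IG : ModelWithCorners ℝ EG HG) (IM : ModelWithCorners ℝ EM HM)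
    (a : G → M → M) : Prop where
  one_act : ∀ x, a 1 x = x
  mul_act : ∀ g g' x, a (g * g') x = a g (a g' x)
  contMDiff : ContMDiff (IG.prod IM) IM ∞ (fun z : G × M => a z.1 z.2)

/-- `p : M → K` is a smooth principal `G`-bundle for the action `a` of `G` on `M`: the fibres of
the surjection `p` are the orbits of `a`, and over a neighbourhood of every point of `K` there is
a `G`-equivariant diffeomorphism from `M` onto the product with `G`.  In particular
`K` is the orbit space `M / G`. -/
structure IsPrincipalBundle (IG : ModelWithCorners ℝ EG HG) (IM : ModelWithCorners ℝ EM HM)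
    (IK : ModelWithCorners ℝ EK HK) (a : G → M → M) (p : M → K) : Prop where
  isSmoothAction : IsSmoothAction IG IM a
  contMDiff : ContMDiff IM IK ∞ p
  surjective : Function.Surjective p
  fiber_iff : ∀ x y, p x = p y ↔ ∃ g, y = a g x
  locally_trivial : ∀ k : K, ∃ (U : Set K) (e : OpenPartialHomeomorph M (K × G)),
    IsOpen U ∧ k ∈ U ∧ e.source = p ⁻¹' U ∧ e.target = U ×ˢ Set.univ ∧
    ContMDiffOn IM (IK.prod IG) ∞ e e.source ∧
    ContMDiffOn (IK.prod IG) IM ∞ e.symm e.target ∧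
    ∀ x ∈ e.source, (e x).1 = p x ∧ ∀ g, (e (a g x)).2 = g * (e x).2

/-- The action of a principal bundle is free. -/
lemma IsPrincipalBundle.eq_one {IG : ModelWithCorners ℝ EG HG} {IM : ModelWithCorners ℝ EM HM}
    {IK : ModelWithCorners ℝ EK HK} {a : G → M → M} {p : M → K}
    (h : IsPrincipalBundle IG IM IK a p) {g : G} {x : M} (hg : a g x = x) : g = 1 := by
  obtain ⟨U, e, -, hk, hs, -, -, -, he⟩ := h.locally_trivial (p x)
  have hx : x ∈ e.source := by rw [hs]; exact hk
  have h1 := (he x hx).2 g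
  rw [hg] at h1
  exact (mul_eq_right.mp h1.symm)

end Principal

/-- A principal action: the action of a smooth principal bundle over some (Hausdorff,
second countable) manifold, i.e. the orbit space is a manifold over which `M` is a principal
bundle. -/
def IsPrincipalAction {EG HG EM HM : Type*}
    [NormedAddCommGroup EG] [NormedSpace ℝ EG] [TopologicalSpace HG]
    [NormedAddCommGroup EM] [NormedSpace ℝ EM] [TopologicalSpace HM]
    {G : Type*} {M : Type u} [Group G]
    [TopologicalSpace G] [ChartedSpace HG G] [TopologicalSpace M] [ChartedSpace HM M]
    (IG : ModelWithCorners ℝ EG HG) (IM : ModelWithCorners ℝ EM HM) (a : G → M → M) : Prop :=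
  ∃ (d : ℕ) (K : Type u) (_ : TopologicalSpace K) (_ : ChartedSpace (EuclideanSpace ℝ (Fin d)) K)
    (p : M → K), IsManifold (𝓡 d) ∞ K ∧ T2Space K ∧ SecondCountableTopology K ∧
      IsPrincipalBundle IG IM (𝓡 d) a p

/-! ## Symplectic manifolds -/

section Symplectic

variable {n : ℕ} {S : Type*} [TopologicalSpace S] [ChartedSpace (EuclideanSpace ℝ (Fin n)) S]

/-- A smooth vector field. -/
def IsSmoothVectorField [IsManifold (𝓡 n) ∞ S] (X : ∀ x : S, TangentSpace (𝓡 n) x) : Prop :=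
  ContMDiff (𝓡 n) (𝓡 n).tangent ∞ (fun x => (⟨x, X x⟩ : TangentBundle (𝓡 n) S))

/-- The derivative `X(f)` of a function along a vector field. -/
def vfDeriv (X : ∀ x : S, TangentSpace (𝓡 n) x) (f : S → ℝ) (x : S) : ℝ :=
  mfderiv (𝓡 n) 𝓘(ℝ, ℝ) f x (X x)

variable (n S) in
/-- A symplectic form: a smooth, closed, non-degenerate `2`-form.  Closedness is expressed by the
invariant formula for the exterior derivative. -/
structure SymplecticForm [IsManifold (𝓡 n) ∞ S] where
  toFun : ∀ x : S, TangentSpace (𝓡 n) x →L[ℝ] TangentSpace (𝓡 n) x →L[ℝ] ℝ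
  smooth : ContMDiff (𝓡 n)
    ((𝓡 n).prod 𝓘(ℝ, EuclideanSpace ℝ (Fin n) →L[ℝ] EuclideanSpace ℝ (Fin n) →L[ℝ] ℝ)) ∞
    (fun x => Bundle.TotalSpace.mk'
      (EuclideanSpace ℝ (Fin n) →L[ℝ] EuclideanSpace ℝ (Fin n) →L[ℝ] ℝ)
      (E := fun x : S => TangentSpace (𝓡 n) x →L[ℝ] TangentSpace (𝓡 n) x →L[ℝ] ℝ) x (toFun x))
  alternating : ∀ x v, toFun x v v = 0
  nondegenerate : ∀ x v, (∀ w, toFun x v w = 0) → v = 0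
  closed : ∀ X Y Z : (∀ x : S, TangentSpace (𝓡 n) x),
    IsSmoothVectorField X → IsSmoothVectorField Y → IsSmoothVectorField Z → ∀ x,
      vfDeriv X (fun y => toFun y (Y y) (Z y)) x
      - vfDeriv Y (fun y => toFun y (X y) (Z y)) x
      + vfDeriv Z (fun y => toFun y (X y) (Y y)) x
      - toFun x (VectorField.mlieBracket (𝓡 n) X Y x) (Z x)
      + toFun x (VectorField.mlieBracket (𝓡 n) X Z x) (Y x)
      - toFun x (VectorField.mlieBracket (𝓡 n) Y Z x) (X x) = 0

variable [IsManifold (𝓡 n) ∞ S]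

/-- The linear map `v ↦ i_v Ω` at a point. -/
def SymplecticForm.flat (Ω : SymplecticForm n S) (x : S) :
    EuclideanSpace ℝ (Fin n) →ₗ[ℝ] Module.Dual ℝ (EuclideanSpace ℝ (Fin n)) where
  toFun v :=
    { toFun := fun w => Ω.toFun x v w
      map_add' := fun w w' => (Ω.toFun x v).map_add w w'
      map_smul' := fun c w => (Ω.toFun x v).map_smul c w }
  map_add' v v' := by
    ext w
    exact DFunLike.congr_fun ((Ω.toFun x).map_add v v') w
  map_smul' c v := by
    ext w
    exact DFunLike.congr_fun ((Ω.toFun x).map_smul c v) w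

lemma SymplecticForm.flat_injective (Ω : SymplecticForm n S) (x : S) :
    Function.Injective (Ω.flat x) := by
  rw [← LinearMap.ker_eq_bot, LinearMap.ker_eq_bot']
  intro v hv
  exact Ω.nondegenerate x v fun w => DFunLike.congr_fun hv w

/-- The Hamiltonian vector field `X_H` of `H`, determined by `i_{X_H} Ω = dH`. -/
def SymplecticForm.hamiltonianVF (Ω : SymplecticForm n S) (H : S → ℝ) (x : S) :
    TangentSpace (𝓡 n) x :=
  ((Ω.flat x).linearEquivOfInjective (Ω.flat_injective x) Subspace.dual_finrank_eq.symm).symm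
    (mfderiv (𝓡 n) 𝓘(ℝ, ℝ) H x : EuclideanSpace ℝ (Fin n) →L[ℝ] ℝ).toLinearMap

lemma SymplecticForm.hamiltonianVF_spec (Ω : SymplecticForm n S) (H : S → ℝ) (x : S)
    (v : TangentSpace (𝓡 n) x) :
    Ω.toFun x (Ω.hamiltonianVF H x) v = mfderiv (𝓡 n) 𝓘(ℝ, ℝ) H x v := by
  have h := ((Ω.flat x).linearEquivOfInjective (Ω.flat_injective x)
    Subspace.dual_finrank_eq.symm).apply_symm_apply
    (mfderiv (𝓡 n) 𝓘(ℝ, ℝ) H x : EuclideanSpace ℝ (Fin n) →L[ℝ] ℝ).toLinearMap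
  rw [LinearMap.linearEquivOfInjective_apply] at h
  exact DFunLike.congr_fun h v

/-- The Poisson bracket of the symplectic form, `{f, g} = Ω(X_g, X_f) = X_f(g)`. -/
def SymplecticForm.poisson (Ω : SymplecticForm n S) (f g : S → ℝ) (x : S) : ℝ :=
  Ω.toFun x (Ω.hamiltonianVF g x) (Ω.hamiltonianVF f x)

/-- `a^* Ω = c Ω`. -/
def SymplecticForm.PullbackEq (Ω : SymplecticForm n S) (a : S → S) (c : ℝ) : Prop :=
  ∀ x (v w : TangentSpace (𝓡 n) x),
    Ω.toFun (a x) (mfderiv (𝓡 n) (𝓡 n) a x v) (mfderiv (𝓡 n) (𝓡 n) a x w) = c * Ω.toFun x v w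

/-- A scaling symmetry of the Hamiltonian system `(S, Ω, H)`: a principal action of the scaling
group for which `Ω` and `H` are homogeneous of degree one. -/
structure IsScalingSymmetry (Ω : SymplecticForm n S) (H : S → ℝ) {Λ : OpenSubgroup ℝˣ}
    (φ : Λ → S → S) : Prop where
  principal : IsPrincipalAction 𝓘(ℝ, ℝ) (𝓡 n) φ
  pullback : ∀ s, Ω.PullbackEq (φ s) (scal s)
  homogeneous : ∀ s x, H (φ s x) = scal s * H x

/-- A symplectic `G`-symmetry of the Hamiltonian system `(S, Ω, H)` with orbit space `P`: the
action of a principal `G`-bundle `q : S → P` that preserves `Ω` and `H`. -/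
structure IsSymplecticSymmetry (Ω : SymplecticForm n S) (H : S → ℝ) (g m : ℕ)
    {G P : Type*} [Group G]
    [TopologicalSpace G] [ChartedSpace (EuclideanSpace ℝ (Fin g)) G]
    [TopologicalSpace P] [ChartedSpace (EuclideanSpace ℝ (Fin m)) P]
    (Φ : G → S → S) (q : S → P) : Prop where
  principal : IsPrincipalBundle (𝓡 g) (𝓡 n) (𝓡 m) Φ q
  pullback : ∀ b, Ω.PullbackEq (Φ b) 1
  invariant : ∀ b x, H (Φ b x) = H x

end Symplectic

/-! ## Poisson manifolds -/

/-- A Poisson bracket on a manifold: a Lie bracket on smooth functions that is a derivation in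
each argument. -/
structure PoissonBracket (m : ℕ) (P : Type*) [TopologicalSpace P]
    [ChartedSpace (EuclideanSpace ℝ (Fin m)) P] where
  bracket : C^∞⟮𝓡 m, P; ℝ⟯ →ₗ[ℝ] C^∞⟮𝓡 m, P; ℝ⟯ →ₗ[ℝ] C^∞⟮𝓡 m, P; ℝ⟯
  self_eq_zero : ∀ f, bracket f f = 0
  jacobi : ∀ f₁ f₂ f₃, bracket f₁ (bracket f₂ f₃) + bracket f₂ (bracket f₃ f₁)
    + bracket f₃ (bracket f₁ f₂) = 0
  leibniz : ∀ f f₁ f₂, bracket (f * f₁) f₂ = f * bracket f₁ f₂ + bracket f f₂ * f₁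

/-- Homogeneous functions (of degree one) for an action of the scaling group. -/
def IsHomogeneous {Λ : OpenSubgroup ℝˣ} {M : Type*} (φ : Λ → M → M) (H : M → ℝ) : Prop :=
  ∀ s x, H (φ s x) = scal s * H x

/-- A scaling symmetry of the Poisson Hamiltonian system `(P, {·,·}, H)`: a principal action of
the scaling group with `{F ∘ φ_s, F' ∘ φ_s} = s ({F, F'} ∘ φ_s)` and `H ∘ φ_s = s H`.
The functions `F ∘ φ_s` are written as smooth functions `F₁`. -/
structure PoissonBracket.IsScalingSymmetry {m : ℕ} {P : Type*} [TopologicalSpace P]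
    [ChartedSpace (EuclideanSpace ℝ (Fin m)) P] (B : PoissonBracket m P)
    (H : C^∞⟮𝓡 m, P; ℝ⟯) {Λ : OpenSubgroup ℝˣ} (φ : Λ → P → P) : Prop where
  principal : IsPrincipalAction 𝓘(ℝ, ℝ) (𝓡 m) φ
  homogeneous_bracket : ∀ (s : Λ) (F F' F₁ F₁' : C^∞⟮𝓡 m, P; ℝ⟯),
    (∀ x, F₁ x = F (φ s x)) → (∀ x, F₁' x = F' (φ s x)) →
    ∀ x, B.bracket F₁ F₁' x = scal s * B.bracket F F' (φ s x)
  homogeneous : IsHomogeneous φ H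

/-! ## The line bundle associated with a principal bundle of the scaling group -/

section LineBundle

variable {m d : ℕ} {M K : Type*} {Λ : OpenSubgroup ℝˣ}
  [TopologicalSpace M] [ChartedSpace (EuclideanSpace ℝ (Fin m)) M]
  [TopologicalSpace K] [ChartedSpace (EuclideanSpace ℝ (Fin d)) K]
  {φ : Λ → M → M} {p : M → K}

/-- The orbit relation of the action `s • (x, t) = (φ_s x, t / s)` on `M × ℝ`. -/
def assocSetoid (h : IsPrincipalBundle 𝓘(ℝ, ℝ) (𝓡 m) (𝓡 d) φ p) : Setoid (M × ℝ) where
  r z w := ∃ s : Λ, w = (φ s z.1, z.2 / scal s)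
  iseqv :=
    { refl := fun z => ⟨1, by simp [h.isSmoothAction.one_act]⟩
      symm := by
        rintro z w ⟨s, rfl⟩
        refine ⟨s⁻¹, Prod.ext ?_ ?_⟩
        · simp [← h.isSmoothAction.mul_act, h.isSmoothAction.one_act]
        · simp [scal_ne_zero]
      trans := by
        rintro z w u ⟨s, rfl⟩ ⟨t, rfl⟩
        refine ⟨t * s, Prod.ext ?_ ?_⟩
        · simp [h.isSmoothAction.mul_act]
        · simp [div_div, mul_comm] }

/-- The total space `L = (M × ℝ) / Λ` of the line bundle associated with `p : M → K`. -/
def LineTotal (h : IsPrincipalBundle 𝓘(ℝ, ℝ) (𝓡 m) (𝓡 d) φ p) : Type _ :=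
  Quotient (assocSetoid h)

/-- The quotient map `M × ℝ → L`. -/
def LineTotal.mk (h : IsPrincipalBundle 𝓘(ℝ, ℝ) (𝓡 m) (𝓡 d) φ p) (x : M) (t : ℝ) :
    LineTotal h :=
  Quotient.mk (assocSetoid h) (x, t)

lemma LineTotal.mk_eq_iff (h : IsPrincipalBundle 𝓘(ℝ, ℝ) (𝓡 m) (𝓡 d) φ p) {x y : M} {t u : ℝ} :
    LineTotal.mk h x t = LineTotal.mk h y u ↔ ∃ s : Λ, y = φ s x ∧ u = t / scal s := by
  exact (Quotient.eq (r := assocSetoid h)).trans (exists_congr fun s => Prod.ext_iff)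

/-- The projection `L → K`. -/
def LineTotal.proj (h : IsPrincipalBundle 𝓘(ℝ, ℝ) (𝓡 m) (𝓡 d) φ p) : LineTotal h → K :=
  Quotient.lift (fun z => p z.1) (by
    rintro z w ⟨s, rfl⟩
    exact (h.fiber_iff _ _).2 ⟨s, rfl⟩)

/-- The fibre `L_k` of the associated line bundle. -/
def LineFiber (h : IsPrincipalBundle 𝓘(ℝ, ℝ) (𝓡 m) (𝓡 d) φ p) (k : K) : Type _ :=
  {l : LineTotal h // LineTotal.proj h l = k}

/-- The class `[x, t]` in the fibre over `p x`. -/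
def LineFiber.mk (h : IsPrincipalBundle 𝓘(ℝ, ℝ) (𝓡 m) (𝓡 d) φ p) (x : M) (t : ℝ) :
    LineFiber h (p x) :=
  ⟨LineTotal.mk h x t, rfl⟩

lemma LineFiber.mkAt_bijective (h : IsPrincipalBundle 𝓘(ℝ, ℝ) (𝓡 m) (𝓡 d) φ p) {k : K} {x : M}
    (hx : p x = k) :
    Function.Bijective (fun t : ℝ => (⟨LineTotal.mk h x t, hx⟩ : LineFiber h k)) := by
  constructor
  · intro t u htu
    obtain ⟨s, hs, hu⟩ := (LineTotal.mk_eq_iff h).1 (Subtype.ext_iff.1 htu)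
    have : s = 1 := h.eq_one hs.symm
    simpa [this] using hu.symm
  · rintro ⟨l, hl⟩
    induction l using Quotient.inductionOn with
    | h z =>
      obtain ⟨y, u⟩ := z
      obtain ⟨s, hs⟩ := (h.fiber_iff x y).1 (hx.trans hl.symm)
      refine ⟨u * scal s, Subtype.ext ?_⟩
      exact (LineTotal.mk_eq_iff h).2 ⟨s, hs, by field_simp [scal_ne_zero s]⟩

/-- The bijection `t ↦ [x, t]` from `ℝ` onto the fibre over `k`, for a chosen point `x` over `k`;
the vector space structure of the fibre is transported along it, and does not depend on the
choice: see `LineFiber.mk_add` and `LineFiber.mk_smul`. -/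
def LineFiber.equiv (h : IsPrincipalBundle 𝓘(ℝ, ℝ) (𝓡 m) (𝓡 d) φ p) (k : K) :
    LineFiber h k ≃ ℝ :=
  (Equiv.ofBijective _ (LineFiber.mkAt_bijective h (h.surjective k).choose_spec)).symm

instance (h : IsPrincipalBundle 𝓘(ℝ, ℝ) (𝓡 m) (𝓡 d) φ p) (k : K) :
    AddCommGroup (LineFiber h k) :=
  (LineFiber.equiv h k).addCommGroup

instance (h : IsPrincipalBundle 𝓘(ℝ, ℝ) (𝓡 m) (𝓡 d) φ p) (k : K) :
    Module ℝ (LineFiber h k) :=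
  (LineFiber.equiv h k).module ℝ

/-- The linear version of `LineFiber.equiv`. -/
def LineFiber.linearEquiv (h : IsPrincipalBundle 𝓘(ℝ, ℝ) (𝓡 m) (𝓡 d) φ p) (k : K) :
    LineFiber h k ≃ₗ[ℝ] ℝ :=
  (LineFiber.equiv h k).linearEquiv ℝ

/-- If `x = φ_s x₀` with `x₀` the chosen point over `p x`, then `[x, t] = [x₀, s t]`. -/
lemma LineFiber.linearEquiv_mk (h : IsPrincipalBundle 𝓘(ℝ, ℝ) (𝓡 m) (𝓡 d) φ p) (x : M) :
    ∃ s : Λ, x = φ s (h.surjective (p x)).choose ∧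
      ∀ t, LineFiber.linearEquiv h (p x) (LineFiber.mk h x t) = scal s * t := by
  obtain ⟨s, hs⟩ := (h.fiber_iff (h.surjective (p x)).choose x).1 (h.surjective (p x)).choose_spec
  refine ⟨s, hs, fun t => ?_⟩
  change LineFiber.equiv h (p x) (LineFiber.mk h x t) = _
  refine (Equiv.symm_apply_eq _).2 (Subtype.ext ?_)
  exact ((LineTotal.mk_eq_iff h).2 ⟨s, hs, by field_simp [scal_ne_zero s]⟩).symm

lemma LineFiber.mk_add (h : IsPrincipalBundle 𝓘(ℝ, ℝ) (𝓡 m) (𝓡 d) φ p) (x : M) (t u : ℝ) :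
    LineFiber.mk h x (t + u) = LineFiber.mk h x t + LineFiber.mk h x u := by
  obtain ⟨s, -, hs⟩ := LineFiber.linearEquiv_mk h x
  apply (LineFiber.linearEquiv h (p x)).injective
  rw [map_add, hs, hs, hs, mul_add]

lemma LineFiber.mk_smul (h : IsPrincipalBundle 𝓘(ℝ, ℝ) (𝓡 m) (𝓡 d) φ p) (x : M) (c t : ℝ) :
    LineFiber.mk h x (c * t) = c • LineFiber.mk h x t := by
  obtain ⟨s, -, hs⟩ := LineFiber.linearEquiv_mk h x
  apply (LineFiber.linearEquiv h (p x)).injective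
  rw [map_smul, hs, hs, smul_eq_mul]
  ring

/-- Smoothness of a section `h` of the dual bundle `L^*`: its values on the local frames
`k ↦ [σ k, 1]` of `L` given by the smooth local sections `σ` of `p : M → K` are smooth functions.
(These frames are the ones that define the smooth vector bundle structure of `L`.) -/
def IsSmoothDualSection (hp : IsPrincipalBundle 𝓘(ℝ, ℝ) (𝓡 m) (𝓡 d) φ p)
    (h : ∀ k, Module.Dual ℝ (LineFiber hp k)) : Prop :=
  ∀ (U : Set K) (σ : K → M), IsOpen U → ContMDiffOn (𝓡 d) (𝓡 m) ∞ σ U →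
    (∀ k ∈ U, p (σ k) = k) →
    ContMDiffOn (𝓡 d) 𝓘(ℝ, ℝ) ∞ (fun k => h (p (σ k)) (LineFiber.mk hp (σ k) 1)) U

/-- The space `Γ(L^*)` of smooth sections of the dual of the associated line bundle. -/
def dualSections (hp : IsPrincipalBundle 𝓘(ℝ, ℝ) (𝓡 m) (𝓡 d) φ p) :
    Submodule ℝ (∀ k, Module.Dual ℝ (LineFiber hp k)) where
  carrier := {h | IsSmoothDualSection hp h}
  add_mem' := fun ha hb U σ hU hσ hpσ => (ha U σ hU hσ hpσ).add (hb U σ hU hσ hpσ)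
  zero_mem' := fun _ _ _ _ _ => contMDiffOn_const
  smul_mem' := fun _ _ ha U σ hU hσ hpσ => contMDiffOn_const.mul (ha U σ hU hσ hpσ)

/-- The product `f h` of a smooth function on `K` with a section of `L^*`. -/
def funSmul (hp : IsPrincipalBundle 𝓘(ℝ, ℝ) (𝓡 m) (𝓡 d) φ p) (f : C^∞⟮𝓡 d, K; ℝ⟯)
    (h : dualSections hp) : dualSections hp :=
  ⟨fun k => f k • h.1 k, fun U σ hU hσ hpσ => by
    refine (f.contMDiff.contMDiffOn.mul (h.2 U σ hU hσ hpσ)).congr fun k hk => ?_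
    simp [hpσ k hk]⟩

/-- The section `h_H` of `L^*` given by a smooth homogeneous function `H` on `M`; it is determined
by `h_H(p x)[x, t] = t H(x)`: see `sectionOf_apply`. -/
def sectionOf (hp : IsPrincipalBundle 𝓘(ℝ, ℝ) (𝓡 m) (𝓡 d) φ p) (H : C^∞⟮𝓡 m, M; ℝ⟯)
    (hH : IsHomogeneous φ H) : dualSections hp :=
  ⟨fun k => H (hp.surjective k).choose • (LineFiber.linearEquiv hp k).toLinearMap,
    fun U σ _ hσ _ => by
      refine (H.contMDiff.comp_contMDiffOn hσ).congr fun k _ => ?_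
      obtain ⟨s, hs, hs'⟩ := LineFiber.linearEquiv_mk hp (σ k)
      have h1 : H (σ k) = scal s * H (hp.surjective (p (σ k))).choose := by
        conv_lhs => rw [hs]
        exact hH _ _
      simp [hs', h1, mul_comm]⟩

lemma sectionOf_apply (hp : IsPrincipalBundle 𝓘(ℝ, ℝ) (𝓡 m) (𝓡 d) φ p) (H : C^∞⟮𝓡 m, M; ℝ⟯)
    (hH : IsHomogeneous φ H) (x : M) (t : ℝ) :
    (sectionOf hp H hH).1 (p x) (LineFiber.mk hp x t) = t * H x := by
  obtain ⟨s, hs, hs'⟩ := LineFiber.linearEquiv_mk hp x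
  have h1 : H x = scal s * H (hp.surjective (p x)).choose := by
    conv_lhs => rw [hs]
    exact hH _ _
  simp only [sectionOf, LinearMap.smul_apply, LinearEquiv.coe_coe, hs', h1, smul_eq_mul]
  ring

/-! ## Kirillov brackets -/

/-- `X` is a symbol of the operator `D = [·, h₂]` on `Γ(L^*)`: `D(f h₁) = f D(h₁) + X(f) h₁`. -/
def IsSymbol (hp : IsPrincipalBundle 𝓘(ℝ, ℝ) (𝓡 m) (𝓡 d) φ p)
    (D : dualSections hp → dualSections hp) (X : ∀ k : K, TangentSpace (𝓡 d) k) : Prop :=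
  ∀ (f : C^∞⟮𝓡 d, K; ℝ⟯) (h₁ : dualSections hp) (k : K),
    (D (funSmul hp f h₁)).1 k = f k • (D h₁).1 k + vfDeriv X f k • h₁.1 k

/-- A Kirillov bracket on `Γ(L^*)`: a Lie bracket such that each `[·, h₂]` is a derivation, with a
smooth vector field on `K` as its symbol. -/
structure KirillovBracket [IsManifold (𝓡 d) ∞ K]
    (hp : IsPrincipalBundle 𝓘(ℝ, ℝ) (𝓡 m) (𝓡 d) φ p) where
  bracket : dualSections hp →ₗ[ℝ] dualSections hp →ₗ[ℝ] dualSections hp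
  self_eq_zero : ∀ h, bracket h h = 0
  jacobi : ∀ h₁ h₂ h₃, bracket h₁ (bracket h₂ h₃) + bracket h₂ (bracket h₃ h₁)
    + bracket h₃ (bracket h₁ h₂) = 0
  derivation : ∀ h₂, ∃ X : ∀ k : K, TangentSpace (𝓡 d) k,
    IsSmoothVectorField X ∧ IsSymbol hp (fun h₁ => bracket h₁ h₂) X

end LineBundle

end

/-!
`G` acts by Poisson maps, so the bracket of two `G`-invariant functions is invariant, and the
bracket of `S` descends to `P`. A map that rescales `Ω` by `c ≠ 0` rescales the Poisson bracket by
`c`, and this conformality descends to `P`; hence homogeneous functions on `P` are closed under the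
bracket. As `h ↦ (y ↦ h(p y)[y, 1])` is a bijection from `Γ(L^*)` onto the homogeneous functions,
the Poisson bracket, up to sign, is a bracket on `Γ(L^*)`.

A conformal map carries the Hamiltonian vector field of a function that it rescales by the same
factor to itself, so Hamiltonian vector fields of invariant functions descend from `S` to `P`, and
those of homogeneous functions from `P` to `K`. By the Leibniz rule, the field on `K` obtained in
this way is the symbol of `[·, h_F]`. Symbols are unique because smooth functions separate tangent
vectors and, at each point, `L^*` has a smooth section that does not vanish there.
-/

noncomputable section

section LieBracket

variable {𝕜 : Type*} [NontriviallyNormedField 𝕜]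
  {E : Type*} [NormedAddCommGroup E] [NormedSpace 𝕜 E]
  {F : Type*} [NormedAddCommGroup F] [NormedSpace 𝕜 F]

lemma fderivWithin_lieBracketWithin {V W : E → E} {f : E → F} {s : Set E} {x : E} {n : ℕ∞ω}
    (hs : UniqueDiffOn 𝕜 s) (hx : x ∈ closure (interior s)) (hxs : x ∈ s)
    (hf : ContDiffWithinAt 𝕜 n f s x) (hn : minSmoothness 𝕜 2 ≤ n)
    (hV : DifferentiableWithinAt 𝕜 V s x) (hW : DifferentiableWithinAt 𝕜 W s x) :
    fderivWithin 𝕜 f s x (VectorField.lieBracketWithin 𝕜 V W s x) =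
      fderivWithin 𝕜 (fun y ↦ fderivWithin 𝕜 f s y (W y)) s x (V x) -
        fderivWithin 𝕜 (fun y ↦ fderivWithin 𝕜 f s y (V y)) s x (W x) := by
  have hsymm : IsSymmSndFDerivWithinAt 𝕜 f s x := hf.isSymmSndFDerivWithinAt hn hs hx hxs
  have hdf : DifferentiableWithinAt 𝕜 (fderivWithin 𝕜 f s) s x :=
    (hf.fderivWithin_right (m := 1) hs (le_minSmoothness.trans hn) hxs).differentiableWithinAt
      one_ne_zero
  rw [fderivWithin_clm_apply (hs x hxs) hdf hW, fderivWithin_clm_apply (hs x hxs) hdf hV,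
    VectorField.lieBracketWithin_eq]
  simp only [map_sub, add_apply, ContinuousLinearMap.comp_apply, ContinuousLinearMap.flip_apply,
    hsymm.eq (V x) (W x)]
  abel

variable {H : Type*} [TopologicalSpace H] {I : ModelWithCorners 𝕜 E H}
  {M : Type*} [TopologicalSpace M] [ChartedSpace H M]

variable (I) in
/-- The expression of a vector field on a manifold in the preferred chart at `x`. -/
def vectorFieldInChart (V : ∀ x : M, TangentSpace I x) (x : M) : E → E :=
  VectorField.mpullbackWithin 𝓘(𝕜, E) I (extChartAt I x).symm V (Set.range I)

lemma differentiableWithinAt_vectorFieldInChart [IsManifold I 2 M] [CompleteSpace E]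
    {V : ∀ x : M, TangentSpace I x} {x : M} (hV : MDiffAt (T% V) x) :
    DifferentiableWithinAt 𝕜 (vectorFieldInChart I V x) (Set.range I) (extChartAt I x x) := by
  have h := MDifferentiableWithinAt.differentiableWithinAt_mpullbackWithin_vectorField
    (mdifferentiableWithinAt_univ.2 hV)
  rwa [Set.preimage_univ, Set.univ_inter] at h

lemma mlieBracket_eq_lieBracketWithin [IsManifold I 1 M] (V W : ∀ x : M, TangentSpace I x) (x : M) :
    VectorField.mlieBracket I V W x =
      VectorField.lieBracketWithin 𝕜 (vectorFieldInChart I V x) (vectorFieldInChart I W x)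
        (Set.range I) (extChartAt I x x) := by
  rw [← VectorField.mlieBracketWithin_univ, VectorField.mlieBracketWithin_apply,
    mfderiv_extChartAt_self, Set.preimage_univ, Set.univ_inter]
  exact congrArg (fun L : E →L[𝕜] E ↦ L _) ContinuousLinearMap.inverse_id

lemma fderivWithin_vectorFieldInChart [IsManifold I 1 M] {f : M → F} {x : M} {y : E}
    (hy : y ∈ (extChartAt I x).target) (hf : MDiffAt f ((extChartAt I x).symm y))
    (V : ∀ x : M, TangentSpace I x) :
    fderivWithin 𝕜 (f ∘ (extChartAt I x).symm) (Set.range I) y (vectorFieldInChart I V x y) =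
      d% f ((extChartAt I x).symm y) (V ((extChartAt I x).symm y)) := by
  rw [← mfderivWithin_eq_fderivWithin, mfderiv_comp_mfderivWithin y hf
    (mdifferentiableWithinAt_extChartAt_symm hy)
    (I.uniqueMDiffOn y (extChartAt_target_subset_range x hy))]
  exact congrArg (d% f _) ((isInvertible_mfderivWithin_extChartAt_symm hy).self_apply_inverse _)

lemma mvfderiv_mvfderiv_eq_fderivWithin [IsManifold I 1 M] {V W : ∀ x : M, TangentSpace I x}
    {f : M → F} {x : M} (hf : ∀ᶠ y in 𝓝 x, MDiffAt f y) (hfW : MDiffAt (fun y ↦ d% f y (W y)) x) :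
    d% (fun y ↦ d% f y (W y)) x (V x) =
      fderivWithin 𝕜 (fun y ↦ fderivWithin 𝕜 (f ∘ (extChartAt I x).symm) (Set.range I) y
        (vectorFieldInChart I W x y)) (Set.range I) (extChartAt I x x)
        (vectorFieldInChart I V x (extChartAt I x x)) := by
  have hx : extChartAt I x x ∈ (extChartAt I x).target := mem_extChartAt_target x
  have hx' : (extChartAt I x).symm (extChartAt I x x) = x := extChartAt_to_inv x
  have key : (fun y ↦ fderivWithin 𝕜 (f ∘ (extChartAt I x).symm) (Set.range I) y
      (vectorFieldInChart I W x y)) =ᶠ[𝓝[Set.range I] extChartAt I x x]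
        (fun y ↦ d% f y (W y)) ∘ (extChartAt I x).symm := by
    have hf' := (continuousAt_extChartAt_symm (I := I) x).eventually (hx'.symm ▸ hf)
    filter_upwards [extChartAt_target_mem_nhdsWithin x, nhdsWithin_le_nhds hf'] with y hy hfy
    exact fderivWithin_vectorFieldInChart hy hfy W
  rw [key.fderivWithin_eq_of_mem ⟨_, rfl⟩, fderivWithin_vectorFieldInChart hx (hx'.symm ▸ hfW), hx']

lemma mvfderiv_mlieBracket [IsManifold I 2 M] [CompleteSpace E] {V W : ∀ x : M, TangentSpace I x}
    {f : M → F} {x : M} (hf : ContMDiffAt I 𝓘(𝕜, F) (minSmoothness 𝕜 2) f x)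
    (hV : MDiffAt (T% V) x) (hW : MDiffAt (T% W) x)
    (hfV : MDiffAt (fun y ↦ d% f y (V y)) x) (hfW : MDiffAt (fun y ↦ d% f y (W y)) x) :
    d% f x (VectorField.mlieBracket I V W x) =
      d% (fun y ↦ d% f y (W y)) x (V x) - d% (fun y ↦ d% f y (V y)) x (W x) := by
  have : IsManifold I 1 M := .of_le one_le_two
  have hf_diff : ∀ᶠ y in 𝓝 x, MDiffAt f y :=
    ((contMDiffAt_iff_contMDiffAt_nhds (by decide)).1 (hf.of_le le_minSmoothness)).mono
      fun y hy ↦ hy.mdifferentiableAt two_ne_zero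
  have hf_chart : ContDiffWithinAt 𝕜 (minSmoothness 𝕜 2) (f ∘ (extChartAt I x).symm)
      (Set.range I) (extChartAt I x x) := (contMDiffAt_iff.1 hf).2
  have hx : extChartAt I x x ∈ Set.range I := Set.mem_range_self _
  rw [mvfderiv_mvfderiv_eq_fderivWithin hf_diff hfW, mvfderiv_mvfderiv_eq_fderivWithin hf_diff hfV,
    ← fderivWithin_lieBracketWithin I.uniqueDiffOn (I.range_subset_closure_interior hx) hx
      hf_chart le_rfl (differentiableWithinAt_vectorFieldInChart hV)
      (differentiableWithinAt_vectorFieldInChart hW),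
    hf_diff.self_of_nhds.mvfderiv, mlieBracket_eq_lieBracketWithin]
  rfl

end LieBracket

section SmoothSections

open Bundle

variable {𝕜 : Type*} [NontriviallyNormedField 𝕜]
  {EB : Type*} [NormedAddCommGroup EB] [NormedSpace 𝕜 EB]
  {HB : Type*} [TopologicalSpace HB] {IB : ModelWithCorners 𝕜 EB HB}
  {B : Type*} [TopologicalSpace B] [ChartedSpace HB B]

section Inverse

variable {F₁ F₂ : Type*} [NormedAddCommGroup F₁] [NormedSpace 𝕜 F₁]
  [NormedAddCommGroup F₂] [NormedSpace 𝕜 F₂] {E₁ E₂ : B → Type*}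
  [∀ x, AddCommGroup (E₁ x)] [∀ x, Module 𝕜 (E₁ x)] [TopologicalSpace (TotalSpace F₁ E₁)]
  [∀ x, TopologicalSpace (E₁ x)] [∀ x, AddCommGroup (E₂ x)] [∀ x, Module 𝕜 (E₂ x)]
  [TopologicalSpace (TotalSpace F₂ E₂)] [∀ x, TopologicalSpace (E₂ x)]
  [FiberBundle F₁ E₁] [VectorBundle 𝕜 F₁ E₁] [FiberBundle F₂ E₂] [VectorBundle 𝕜 F₂ E₂]

lemma isInvertible_inCoordinates {x₀ x : B} {L : E₁ x →L[𝕜] E₂ x} (hL : L.IsInvertible)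
    (hx₁ : x ∈ (trivializationAt F₁ E₁ x₀).baseSet)
    (hx₂ : x ∈ (trivializationAt F₂ E₂ x₀).baseSet) :
    (ContinuousLinearMap.inCoordinates F₁ E₁ F₂ E₂ x₀ x x₀ x L).IsInvertible := by
  rw [ContinuousLinearMap.inCoordinates_eq hx₁ hx₂]
  exact ContinuousLinearMap.isInvertible_equiv.comp
    (hL.comp ContinuousLinearMap.isInvertible_equiv)

variable [∀ x, IsTopologicalAddGroup (E₂ x)] [∀ x, ContinuousSMul 𝕜 (E₂ x)]

lemma contMDiffAt_section_of_clm_apply [CompleteSpace F₁] {n : ℕ∞ω} {L : ∀ x, E₁ x →L[𝕜] E₂ x}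
    {v : ∀ x, E₁ x} {x₀ : B}
    (hL : ContMDiffAt IB (IB.prod 𝓘(𝕜, F₁ →L[𝕜] F₂)) n (fun x ↦ TotalSpace.mk' (F₁ →L[𝕜] F₂)
      (E := fun x ↦ E₁ x →L[𝕜] E₂ x) x (L x)) x₀)
    (hL_inv : ∀ x, (L x).IsInvertible)
    (hv : CMDiffAt n (T% fun x ↦ L x (v x)) x₀) :
    CMDiffAt n (T% v) x₀ := by
  rw [contMDiffAt_hom_bundle] at hL
  rw [contMDiffAt_totalSpace] at hv ⊢
  have hx₁ : ∀ᶠ x in 𝓝 x₀, x ∈ (trivializationAt F₁ E₁ x₀).baseSet :=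
    (trivializationAt F₁ E₁ x₀).open_baseSet.mem_nhds (FiberBundle.mem_baseSet_trivializationAt' x₀)
  have hx₂ : ∀ᶠ x in 𝓝 x₀, x ∈ (trivializationAt F₂ E₂ x₀).baseSet :=
    (trivializationAt F₂ E₂ x₀).open_baseSet.mem_nhds (FiberBundle.mem_baseSet_trivializationAt' x₀)
  have hinv := isInvertible_inCoordinates (hL_inv x₀) hx₁.self_of_nhds hx₂.self_of_nhds
  refine ⟨contMDiffAt_id, ContMDiffAt.congr_of_eventuallyEq
    ((hinv.contDiffAt_map_inverse.contMDiffAt.comp x₀ hL.2).clm_apply hv.2) ?_⟩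
  filter_upwards [hx₁, hx₂] with x hx₁ hx₂
  refine ((isInvertible_inCoordinates (hL_inv x) hx₁ hx₂).inverse_apply_eq.2 ?_).symm
  simp [ContinuousLinearMap.inCoordinates_eq hx₁ hx₂, hx₁]

end Inverse

variable {F : Type*} [NormedAddCommGroup F] [NormedSpace 𝕜 F]

lemma contMDiffAt_mvfderiv_section [IsManifold IB 1 B] {m n : ℕ∞ω} {f : B → F} {x₀ : B}
    (hf : CMDiffAt n f x₀) (hmn : m + 1 ≤ n) :
    ContMDiffAt IB (IB.prod 𝓘(𝕜, EB →L[𝕜] F)) m (fun x ↦ TotalSpace.mk' (EB →L[𝕜] F)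
      (E := fun x ↦ TangentSpace IB x →L[𝕜] F) x (mvfderiv IB f x)) x₀ := by
  rw [contMDiffAt_hom_bundle]
  refine ⟨contMDiffAt_id, (hf.mfderiv_const hmn).congr_of_eventuallyEq (.of_eq (funext fun x ↦ ?_))⟩
  ext v
  simp only [inTangentCoordinates, ContinuousLinearMap.inCoordinates,
    ContinuousLinearMap.comp_apply, TangentBundle.continuousLinearMapAt_model_space]
  exact DFunLike.congr_fun (Trivial.continuousLinearMapAt_trivialization 𝕜 _ F x) _

lemma contMDiff_mvfderiv_apply [IsManifold IB 1 B] {m n : ℕ∞ω} {f : B → F}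
    {X : ∀ x : B, TangentSpace IB x} (hf : CMDiff n f) (hX : CMDiff m (T% X)) (hmn : m + 1 ≤ n) :
    CMDiff m (fun x ↦ d% f x (X x)) :=
  (contMDiff_snd_tangentBundle_modelSpace F 𝓘(𝕜, F)).comp ((hf.contMDiff_tangentMap hmn).comp hX)

end SmoothSections

section TangentVectors

variable {E H M : Type*} [NormedAddCommGroup E] [NormedSpace ℝ E] [FiniteDimensional ℝ E]
  [TopologicalSpace H] {I : ModelWithCorners ℝ E H} [TopologicalSpace M] [ChartedSpace H M]
  [IsManifold I ∞ M] [T2Space M]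

lemma exists_contMDiff_eventuallyEq_extChartAt (x : M) :
    ∃ F : M → E, CMDiff ∞ F ∧ F =ᶠ[𝓝 x] extChartAt I x := by
  obtain ⟨ρ⟩ : Nonempty (SmoothBumpFunction I x) := inferInstance
  refine ⟨fun y ↦ ρ y • extChartAt I x y, ρ.contMDiff_smul contMDiffOn_extChartAt, ?_⟩
  filter_upwards [ρ.eventuallyEq_one] with y hy
  rw [hy, Pi.one_apply, one_smul]

lemma tangentSpace_ext {x : M} {v w : TangentSpace I x}
    (h : ∀ f : C^∞⟮I, M; ℝ⟯, d% f x v = d% f x w) : v = w := by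
  obtain ⟨F, hF, hF_chart⟩ := exists_contMDiff_eventuallyEq_extChartAt (I := I) x
  have hd : ∀ u : TangentSpace I x, mfderiv% F x u = u := fun u ↦ by
    rw [hF_chart.mfderiv_eq, mfderiv_extChartAt_self]
    rfl
  have hcomp : ∀ (ℓ : StrongDual ℝ E) (u : TangentSpace I x), d% (ℓ ∘ F) x u = ℓ u := fun ℓ u ↦ by
    rw [mvfderiv_comp x ℓ.mdifferentiableAt (hF.mdifferentiableAt (by decide))]
    exact (congrArg (d% ℓ (F x)) (hd u)).trans (DFunLike.congr_fun ℓ.mfderiv_eq u)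
  refine (SeparatingDual.eq_iff_forall_dual_eq (R := ℝ) (V := E)).2 fun ℓ ↦ ?_
  rw [← hcomp ℓ v, ← hcomp ℓ w]
  exact h ⟨ℓ ∘ F, ℓ.contMDiff.comp hF⟩

end TangentVectors

section HamiltonianVectorField

variable {n : ℕ} {S : Type*} [TopologicalSpace S] [ChartedSpace (EuclideanSpace ℝ (Fin n)) S]

lemma vfDeriv_comp {k : ℕ} {K : Type*} [TopologicalSpace K]
    [ChartedSpace (EuclideanSpace ℝ (Fin k)) K] (X : ∀ x : S, TangentSpace (𝓡 n) x) {f : K → ℝ}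
    {p : S → K} {x : S} (hf : MDifferentiableAt (𝓡 k) 𝓘(ℝ, ℝ) f (p x))
    (hp : MDifferentiableAt (𝓡 n) (𝓡 k) p x) :
    vfDeriv X (fun y ↦ f (p y)) x = mvfderiv (𝓡 k) f (p x) (mfderiv (𝓡 n) (𝓡 k) p x (X x)) :=
  congrArg (fun L ↦ L (X x)) (mvfderiv_comp x hf hp)

variable [IsManifold (𝓡 n) ∞ S]

lemma IsSmoothVectorField.mdifferentiableAt {X : ∀ x : S, TangentSpace (𝓡 n) x}
    (hX : IsSmoothVectorField X) (x : S) :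
    MDifferentiableAt (𝓡 n) (𝓡 n).tangent (fun x ↦ (⟨x, X x⟩ : TangentBundle (𝓡 n) S)) x :=
  (hX x).mdifferentiableAt (by decide)

lemma IsSmoothVectorField.contMDiff_vfDeriv {X : ∀ x : S, TangentSpace (𝓡 n) x}
    (hX : IsSmoothVectorField X) {f : S → ℝ} (hf : ContMDiff (𝓡 n) 𝓘(ℝ, ℝ) ∞ f) :
    ContMDiff (𝓡 n) 𝓘(ℝ, ℝ) ∞ (vfDeriv X f) :=
  contMDiff_mvfderiv_apply hf hX le_rfl

/-- The derivation of the algebra of smooth functions given by a smooth vector field. -/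
def IsSmoothVectorField.derivation {X : ∀ x : S, TangentSpace (𝓡 n) x}
    (hX : IsSmoothVectorField X) : Derivation ℝ C^∞⟮𝓡 n, S; ℝ⟯ C^∞⟮𝓡 n, S; ℝ⟯ :=
  Derivation.mk'
    { toFun f := ⟨vfDeriv X f, hX.contMDiff_vfDeriv f.contMDiff⟩
      map_add' f g := ContMDiffMap.ext fun x ↦ congrArg (fun L ↦ L (X x))
        (mvfderiv_add (f.mdifferentiableAt) (g.mdifferentiableAt))
      map_smul' c f := ContMDiffMap.ext fun x ↦ congrArg (fun L ↦ L (X x))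
        (const_smul_mfderiv f.mdifferentiableAt c) }
    fun f g ↦ ContMDiffMap.ext fun x ↦ congrArg (fun L ↦ L (X x))
      (mvfderiv_mul (f.mdifferentiableAt) (g.mdifferentiableAt))

lemma IsSmoothVectorField.vfDeriv_mlieBracket {X Y : ∀ x : S, TangentSpace (𝓡 n) x}
    (hX : IsSmoothVectorField X) (hY : IsSmoothVectorField Y) {f : S → ℝ}
    (hf : ContMDiff (𝓡 n) 𝓘(ℝ, ℝ) ∞ f) (x : S) :
    vfDeriv (VectorField.mlieBracket (𝓡 n) X Y) f x =
      vfDeriv X (vfDeriv Y f) x - vfDeriv Y (vfDeriv X f) x :=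
  have : IsManifold (𝓡 n) 2 S := .of_le (n := ∞) (by decide)
  mvfderiv_mlieBracket ((hf x).of_le (by simpa using by decide)) (hX.mdifferentiableAt x)
    (hY.mdifferentiableAt x) ((hX.contMDiff_vfDeriv hf x).mdifferentiableAt (by decide))
    ((hY.contMDiff_vfDeriv hf x).mdifferentiableAt (by decide))

namespace SymplecticForm

variable (Ω : SymplecticForm n S)

lemma isInvertible_toFun (x : S) : (Ω.toFun x).IsInvertible :=
  ⟨(((Ω.flat x).linearEquivOfInjective (Ω.flat_injective x) Subspace.dual_finrank_eq.symm).trans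
    LinearMap.toContinuousLinearMap).toContinuousLinearEquiv, rfl⟩

lemma toFun_hamiltonianVF (f : S → ℝ) (x : S) :
    Ω.toFun x (Ω.hamiltonianVF f x) = mvfderiv (𝓡 n) f x :=
  ContinuousLinearMap.ext (Ω.hamiltonianVF_spec f x)

lemma isSmoothVectorField_hamiltonianVF {f : S → ℝ} (hf : ContMDiff (𝓡 n) 𝓘(ℝ, ℝ) ∞ f) :
    IsSmoothVectorField (Ω.hamiltonianVF f) := fun x ↦
  contMDiffAt_section_of_clm_apply (Ω.smooth x) Ω.isInvertible_toFun <| by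
    simpa only [toFun_hamiltonianVF] using contMDiffAt_mvfderiv_section (hf x) le_rfl

lemma antisymm (x : S) (v w : TangentSpace (𝓡 n) x) : Ω.toFun x v w = -Ω.toFun x w v := by
  have h := Ω.alternating x (v + w)
  simp only [map_add, add_apply, Ω.alternating] at h
  linarith

lemma poisson_eq_vfDeriv (f g : S → ℝ) : Ω.poisson f g = vfDeriv (Ω.hamiltonianVF f) g :=
  funext fun x ↦ Ω.hamiltonianVF_spec g x _

lemma poisson_antisymm (f g : S → ℝ) : Ω.poisson f g = -Ω.poisson g f :=
  funext fun x ↦ Ω.antisymm x _ _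

lemma poisson_neg (f g : S → ℝ) : Ω.poisson f (-g) = -Ω.poisson f g := by
  simp only [poisson_eq_vfDeriv]
  exact funext fun x ↦ DFunLike.congr_fun (mvfderiv_neg (I := 𝓡 n) (g := g) (x := x)) _

lemma toFun_mlieBracket_hamiltonianVF {f g : S → ℝ} (hf : ContMDiff (𝓡 n) 𝓘(ℝ, ℝ) ∞ f)
    (hg : ContMDiff (𝓡 n) 𝓘(ℝ, ℝ) ∞ g) {h : S → ℝ} (hh : ContMDiff (𝓡 n) 𝓘(ℝ, ℝ) ∞ h) (x : S) :
    Ω.toFun x (VectorField.mlieBracket (𝓡 n) (Ω.hamiltonianVF f) (Ω.hamiltonianVF g) x)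
        (Ω.hamiltonianVF h x) =
      Ω.poisson g (Ω.poisson f h) x - Ω.poisson f (Ω.poisson g h) x := by
  have hbracket := (Ω.isSmoothVectorField_hamiltonianVF hf).vfDeriv_mlieBracket
    (Ω.isSmoothVectorField_hamiltonianVF hg) hh x
  rw [Ω.antisymm, Ω.hamiltonianVF_spec]
  simp only [poisson_eq_vfDeriv]
  rw [← neg_sub, ← hbracket]
  rfl

lemma derivation_antisymm (f g : C^∞⟮𝓡 n, S; ℝ⟯) :
    (Ω.isSmoothVectorField_hamiltonianVF f.contMDiff).derivation g =
      -(Ω.isSmoothVectorField_hamiltonianVF g.contMDiff).derivation f :=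
  ContMDiffMap.ext fun x ↦ by
    have := congrFun (Ω.poisson_antisymm f g) x
    simp only [poisson_eq_vfDeriv] at this
    exact this

lemma poisson_jacobi {f g h : S → ℝ} (hf : ContMDiff (𝓡 n) 𝓘(ℝ, ℝ) ∞ f)
    (hg : ContMDiff (𝓡 n) 𝓘(ℝ, ℝ) ∞ g) (hh : ContMDiff (𝓡 n) 𝓘(ℝ, ℝ) ∞ h) :
    Ω.poisson f (Ω.poisson g h) + Ω.poisson g (Ω.poisson h f) +
      Ω.poisson h (Ω.poisson f g) = 0 := by
  ext x
  have hclosed := Ω.closed _ _ _ (Ω.isSmoothVectorField_hamiltonianVF hf)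
    (Ω.isSmoothVectorField_hamiltonianVF hg) (Ω.isSmoothVectorField_hamiltonianVF hh) x
  rw [Ω.toFun_mlieBracket_hamiltonianVF hf hg hh, Ω.toFun_mlieBracket_hamiltonianVF hf hh hg,
    Ω.toFun_mlieBracket_hamiltonianVF hg hh hf] at hclosed
  change vfDeriv _ (Ω.poisson h g) x - vfDeriv _ (Ω.poisson h f) x
    + vfDeriv _ (Ω.poisson g f) x - _ + _ - _ = 0 at hclosed
  simp only [← poisson_eq_vfDeriv, Ω.poisson_antisymm h g, Ω.poisson_antisymm g f,
    Ω.poisson_antisymm f h, poisson_neg, Pi.neg_apply, Pi.add_apply, Pi.zero_apply] at hclosed ⊢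
  linarith

/-- The Poisson bracket of a symplectic form, as a Poisson structure on the algebra of smooth
functions. -/
def poissonBracket : PoissonBracket n S where
  bracket := LinearMap.mk₂ ℝ
    (fun f g ↦ (Ω.isSmoothVectorField_hamiltonianVF f.contMDiff).derivation g)
    (fun f f' g ↦ by simp only [Ω.derivation_antisymm _ g, map_add, neg_add])
    (fun c f g ↦ by
      simp only [Ω.derivation_antisymm _ g, smul_neg]
      exact congrArg Neg.neg (Derivation.map_smul _ c f))
    (fun f ↦ map_add _) (fun c f g ↦ Derivation.map_smul _ c g)
  self_eq_zero f := ContMDiffMap.ext fun x ↦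
    (congrFun (Ω.poisson_eq_vfDeriv f f) x).symm.trans (Ω.alternating x _)
  jacobi f g h := ContMDiffMap.ext fun x ↦ by
    have := congrFun (Ω.poisson_jacobi f.contMDiff g.contMDiff h.contMDiff) x
    simp only [poisson_eq_vfDeriv] at this
    exact this
  leibniz f g h := by
    simp only [LinearMap.mk₂_apply, Ω.derivation_antisymm _ h, Derivation.leibniz, smul_eq_mul]
    ring

lemma poissonBracket_apply (f g : C^∞⟮𝓡 n, S; ℝ⟯) (x : S) :
    Ω.poissonBracket.bracket f g x = Ω.poisson f g x :=
  (congrFun (Ω.poisson_eq_vfDeriv f g) x).symm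

end SymplecticForm

end HamiltonianVectorField

section ConformalMaps

namespace SymplecticForm

variable {n : ℕ} {S : Type*} [TopologicalSpace S] [ChartedSpace (EuclideanSpace ℝ (Fin n)) S]
  [IsManifold (𝓡 n) ∞ S] {Ω : SymplecticForm n S} {a : S → S} {c : ℝ}

lemma PullbackEq.mfderiv_surjective (h : Ω.PullbackEq a c) (hc : c ≠ 0) (x : S) :
    Function.Surjective (mfderiv (𝓡 n) (𝓡 n) a x) := by
  let A : EuclideanSpace ℝ (Fin n) →ₗ[ℝ] EuclideanSpace ℝ (Fin n) :=
    (mfderiv (𝓡 n) (𝓡 n) a x).toLinearMap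
  refine (LinearMap.injective_iff_surjective (f := A)).1
    ((injective_iff_map_eq_zero A).2 fun v hv ↦ Ω.nondegenerate x v fun w ↦ ?_)
  have hv' : mfderiv (𝓡 n) (𝓡 n) a x v = 0 := hv
  have hvw := h x v w
  rw [hv', map_zero] at hvw
  exact (mul_eq_zero.1 hvw.symm).resolve_left hc

lemma PullbackEq.mfderiv_hamiltonianVF_comp (h : Ω.PullbackEq a c) (hc : c ≠ 0) {f : S → ℝ}
    {x : S} (hf : MDifferentiableAt (𝓡 n) 𝓘(ℝ, ℝ) f (a x))
    (ha : MDifferentiableAt (𝓡 n) (𝓡 n) a x) :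
    mfderiv (𝓡 n) (𝓡 n) a x (Ω.hamiltonianVF (f ∘ a) x) = c • Ω.hamiltonianVF f (a x) := by
  rw [← sub_eq_zero]
  refine Ω.nondegenerate (a x) _ fun w ↦ ?_
  obtain ⟨v, rfl⟩ := h.mfderiv_surjective hc x w
  rw [map_sub, map_smul, sub_apply, smul_apply, h, Ω.toFun_hamiltonianVF, Ω.toFun_hamiltonianVF,
    mvfderiv_comp x hf ha]
  exact sub_self _

lemma PullbackEq.poisson_comp (h : Ω.PullbackEq a c) (hc : c ≠ 0) {f g : S → ℝ} {x : S}
    (hf : MDifferentiableAt (𝓡 n) 𝓘(ℝ, ℝ) f (a x)) (hg : MDifferentiableAt (𝓡 n) 𝓘(ℝ, ℝ) g (a x))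
    (ha : MDifferentiableAt (𝓡 n) (𝓡 n) a x) :
    Ω.poisson (f ∘ a) (g ∘ a) x = c * Ω.poisson f g (a x) := by
  rw [poisson_eq_vfDeriv, poisson_eq_vfDeriv, Function.comp_def g, vfDeriv_comp _ hg ha,
    h.mfderiv_hamiltonianVF_comp hc hf ha, map_smul]
  rfl

end SymplecticForm

end ConformalMaps

section LocalSections

variable {𝕜 : Type*} [NontriviallyNormedField 𝕜]
  {EM HM M EK HK K EN HN N : Type*}
  [NormedAddCommGroup EM] [NormedSpace 𝕜 EM] [TopologicalSpace HM] {IM : ModelWithCorners 𝕜 EM HM}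
  [TopologicalSpace M] [ChartedSpace HM M]
  [NormedAddCommGroup EK] [NormedSpace 𝕜 EK] [TopologicalSpace HK] {IK : ModelWithCorners 𝕜 EK HK}
  [TopologicalSpace K] [ChartedSpace HK K]
  [NormedAddCommGroup EN] [NormedSpace 𝕜 EN] [TopologicalSpace HN] {IN : ModelWithCorners 𝕜 EN HN}
  [TopologicalSpace N] [ChartedSpace HN N]

variable (IM IK) in
/-- The map `p` has a smooth local section around every point of its target. The section is a
globally defined function of which only the germ at the point matters. -/
def HasSmoothLocalSections (p : M → K) : Prop :=
  ∀ k, ∃ σ : K → M, CMDiffAt ∞ σ k ∧ ∀ᶠ k' in 𝓝 k, p (σ k') = k'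

namespace HasSmoothLocalSections

variable {p : M → K}

lemma surjective (hp : HasSmoothLocalSections IM IK p) : Function.Surjective p := fun k ↦
  let ⟨σ, _, hσ⟩ := hp k
  ⟨σ k, hσ.self_of_nhds⟩

lemma contMDiffOn_of_comp (hp : HasSmoothLocalSections IM IK p) {f : K → N} {U : Set K}
    (hf : CMDiff[p ⁻¹' U] ∞ (f ∘ p)) : CMDiff[U] ∞ f := fun k hk ↦ by
  obtain ⟨σ, hσ, hpσ⟩ := hp k
  have hσU : σ ⁻¹' (p ⁻¹' U) ∈ 𝓝[U] k := by
    filter_upwards [nhdsWithin_le_nhds hpσ, self_mem_nhdsWithin] with k' hk' hk'U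
    rwa [Set.mem_preimage, Set.mem_preimage, hk']
  have hσk : k ∈ σ ⁻¹' (p ⁻¹' U) := mem_of_mem_nhdsWithin hk hσU
  refine (((hf (σ k) hσk).comp' k hσ.contMDiffWithinAt).mono_of_mem_nhdsWithin
    (Filter.inter_mem self_mem_nhdsWithin hσU)).congr_of_eventuallyEq ?_
    (congrArg f hpσ.self_of_nhds).symm
  filter_upwards [nhdsWithin_le_nhds hpσ] with k' hk'
  exact congrArg f hk'.symm

lemma contMDiff_of_comp (hp : HasSmoothLocalSections IM IK p) {f : K → N}
    (hf : CMDiff ∞ (f ∘ p)) : CMDiff ∞ f :=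
  contMDiffOn_univ.1 (hp.contMDiffOn_of_comp hf.contMDiffOn)

lemma prodMap_id (hp : HasSmoothLocalSections IM IK p) :
    HasSmoothLocalSections (IN.prod IM) (IN.prod IK) (Prod.map (id : N → N) p) := fun ⟨y, k⟩ ↦ by
  obtain ⟨σ, hσ, hpσ⟩ := hp k
  refine ⟨Prod.map id σ, contMDiffAt_id.prodMap hσ, ?_⟩
  filter_upwards [continuousAt_snd.eventually hpσ] with z hz
  exact Prod.ext rfl hz

lemma exists_projected_vectorField [IsManifold IM 1 M] [IsManifold IK 1 K]
    (hp : HasSmoothLocalSections IM IK p) (hp_smooth : CMDiff ∞ p)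
    {X : ∀ x : M, TangentSpace IM x} (hX : CMDiff ∞ (T% X))
    (hX_fib : ∀ x y, p x = p y → tangentMap IM IK p ⟨x, X x⟩ = tangentMap IM IK p ⟨y, X y⟩) :
    ∃ Y : ∀ k : K, TangentSpace IK k, CMDiff ∞ (T% Y) ∧ ∀ x, mfderiv% p x (X x) = Y (p x) := by
  let s : K → M := Function.surjInv hp.surjective
  have hs : ∀ k, p (s k) = k := Function.surjInv_eq hp.surjective
  let Y (k : K) : TangentSpace IK k := mfderiv IM IK p (s k) (X (s k))
  have hY : ∀ x, tangentMap IM IK p ⟨x, X x⟩ = ⟨p x, Y (p x)⟩ := fun x ↦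
    (hX_fib x (s (p x)) (hs _).symm).trans (congrArg (Bundle.TotalSpace.mk · (Y (p x))) (hs _))
  refine ⟨Y, hp.contMDiff_of_comp (IM := IM) ?_, fun x ↦ congrArg (fun z ↦ (z.2 : EK)) (hY x)⟩
  exact ((hp_smooth.contMDiff_tangentMap le_rfl).comp hX).congr fun x ↦ (hY x).symm

end HasSmoothLocalSections

end LocalSections

section PrincipalBundles

variable {EG HG EM HM EK HK EL HL EP HP : Type*}
  [NormedAddCommGroup EG] [NormedSpace ℝ EG] [TopologicalSpace HG]
  [NormedAddCommGroup EM] [NormedSpace ℝ EM] [TopologicalSpace HM]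
  [NormedAddCommGroup EK] [NormedSpace ℝ EK] [TopologicalSpace HK]
  [NormedAddCommGroup EL] [NormedSpace ℝ EL] [TopologicalSpace HL]
  [NormedAddCommGroup EP] [NormedSpace ℝ EP] [TopologicalSpace HP]
  {G M K L P : Type*} [Group G] [Group L]
  [TopologicalSpace G] [ChartedSpace HG G]
  [TopologicalSpace M] [ChartedSpace HM M]
  [TopologicalSpace K] [ChartedSpace HK K]
  [TopologicalSpace L] [ChartedSpace HL L]
  [TopologicalSpace P] [ChartedSpace HP P]
  {IG : ModelWithCorners ℝ EG HG} {IM : ModelWithCorners ℝ EM HM}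
  {IK : ModelWithCorners ℝ EK HK} {IL : ModelWithCorners ℝ EL HL}
  {IP : ModelWithCorners ℝ EP HP}
  {a : G → M → M} {p : M → K} {U : Set K} {σ : K → M} {τ : M → G}

namespace IsSmoothAction

lemma inv_act (h : IsSmoothAction IG IM a) (g : G) (x : M) : a g⁻¹ (a g x) = x := by
  rw [← h.mul_act, inv_mul_cancel, h.one_act]

lemma contMDiff_act (h : IsSmoothAction IG IM a) (g : G) : ContMDiff IM IM ∞ (a g) :=
  h.contMDiff.comp (contMDiff_const.prodMk contMDiff_id)

end IsSmoothAction

variable (IG IM IK) in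
/-- A local gauge over an open set `U` of a bundle `p : M → K` with an action `a` of `G`: a smooth
section `σ` over `U`, together with the smooth equivariant coordinate `τ` on `p ⁻¹' U` for which
`x = τ(x) • σ(p x)`. Local gauges are the local trivializations of principal bundles. -/
structure IsLocalGauge (a : G → M → M) (p : M → K) (U : Set K) (σ : K → M) (τ : M → G) :
    Prop where
  isOpen : IsOpen U
  contMDiffOn_section : ContMDiffOn IK IM ∞ σ U
  proj_section : ∀ k ∈ U, p (σ k) = k
  contMDiffOn_coord : ContMDiffOn IM IG ∞ τ (p ⁻¹' U)
  coord_act_section : ∀ x, p x ∈ U → a (τ x) (σ (p x)) = x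
  coord_act : ∀ g x, p x ∈ U → τ (a g x) = g * τ x

namespace IsLocalGauge

lemma coord_section (h : IsLocalGauge IG IM IK a p U σ τ) {k : K} (hk : k ∈ U) :
    τ (σ k) = 1 := by
  have hmem : p (σ k) ∈ U := by rwa [h.proj_section k hk]
  have hτ := h.coord_act (τ (σ k)) (σ k) hmem
  have hσ := h.coord_act_section (σ k) hmem
  rw [h.proj_section k hk] at hσ
  rwa [hσ, right_eq_mul] at hτ

lemma exists_trivialization (h : IsLocalGauge IG IM IK a p U σ τ) (ha : IsSmoothAction IG IM a)
    (hp : ContMDiff IM IK ∞ p) (hpa : ∀ g x, p (a g x) = p x) :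
    ∃ e : OpenPartialHomeomorph M (K × G),
      e.source = p ⁻¹' U ∧ e.target = U ×ˢ Set.univ ∧
      ContMDiffOn IM (IK.prod IG) ∞ e e.source ∧
      ContMDiffOn (IK.prod IG) IM ∞ e.symm e.target ∧
      ∀ x ∈ e.source, (e x).1 = p x ∧ ∀ g, (e (a g x)).2 = g * (e x).2 := by
  have he : ContMDiffOn IM (IK.prod IG) ∞ (fun x ↦ (p x, τ x)) (p ⁻¹' U) :=
    hp.contMDiffOn.prodMk h.contMDiffOn_coord
  have he' : ContMDiffOn (IK.prod IG) IM ∞ (fun z : K × G ↦ a z.2 (σ z.1)) (U ×ˢ Set.univ) :=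
    ha.contMDiff.comp_contMDiffOn (contMDiffOn_snd.prodMk
      (h.contMDiffOn_section.comp contMDiffOn_fst fun z hz ↦ hz.1))
  have hpσ : ∀ z ∈ U ×ˢ (Set.univ : Set G), p (a z.2 (σ z.1)) = z.1 := fun z hz ↦ by
    rw [hpa, h.proj_section _ hz.1]
  refine ⟨
    { toFun x := (p x, τ x)
      invFun z := a z.2 (σ z.1)
      source := p ⁻¹' U
      target := U ×ˢ Set.univ
      map_source' x hx := ⟨hx, trivial⟩
      map_target' z hz := by rw [Set.mem_preimage, hpσ z hz]; exact hz.1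
      left_inv' := h.coord_act_section
      right_inv' z hz := Prod.ext (hpσ z hz) <| by
        change τ (a z.2 (σ z.1)) = z.2
        rw [h.coord_act _ _ (by rw [h.proj_section _ hz.1]; exact hz.1), h.coord_section hz.1,
          mul_one]
      open_source := h.isOpen.preimage hp.continuous
      open_target := h.isOpen.prod isOpen_univ
      continuousOn_toFun := he.continuousOn
      continuousOn_invFun := he'.continuousOn }, rfl, rfl, he, he', fun x hx ↦ ⟨rfl, fun g ↦ ?_⟩⟩
  exact h.coord_act g x hx

end IsLocalGauge

namespace IsPrincipalBundle

lemma of_localGauges (ha : IsSmoothAction IG IM a) (hp : ContMDiff IM IK ∞ p)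
    (hpa : ∀ g x, p (a g x) = p x)
    (h : ∀ k, ∃ U σ τ, IsLocalGauge IG IM IK a p U σ τ ∧ k ∈ U) :
    IsPrincipalBundle IG IM IK a p where
  isSmoothAction := ha
  contMDiff := hp
  surjective k :=
    let ⟨_, σ, _, hgauge, hk⟩ := h k
    ⟨σ k, hgauge.proj_section k hk⟩
  fiber_iff x y := by
    refine ⟨fun hxy ↦ ?_, fun ⟨g, hg⟩ ↦ by rw [hg, hpa]⟩
    obtain ⟨U, σ, τ, hgauge, hx⟩ := h (p x)
    have hτx : a (τ x)⁻¹ x = σ (p x) :=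
      (congrArg (a (τ x)⁻¹) (hgauge.coord_act_section x hx)).symm.trans (ha.inv_act _ _)
    have hτy : a (τ y) (σ (p y)) = y := hgauge.coord_act_section y (hxy ▸ hx)
    exact ⟨τ y * (τ x)⁻¹, by rw [ha.mul_act, hτx, hxy, hτy]⟩
  locally_trivial k := by
    obtain ⟨U, σ, τ, hgauge, hk⟩ := h k
    obtain ⟨e, he⟩ := hgauge.exists_trivialization ha hp hpa
    exact ⟨U, e, hgauge.isOpen, hk, he⟩

lemma proj_act (h : IsPrincipalBundle IG IM IK a p) (g : G) (x : M) : p (a g x) = p x :=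
  ((h.fiber_iff x _).2 ⟨g, rfl⟩).symm

lemma exists_isLocalGauge (h : IsPrincipalBundle IG IM IK a p) (k : K) :
    ∃ U σ τ, IsLocalGauge IG IM IK a p U σ τ ∧ k ∈ U := by
  obtain ⟨U, e, hU, hk, hsource, htarget, he, he', hcoord⟩ := h.locally_trivial k
  have hmem : ∀ k ∈ U, ∀ g : G, (k, g) ∈ e.target := fun k hk g ↦ htarget ▸ ⟨hk, trivial⟩
  have hsec : ∀ k ∈ U, p (e.symm (k, 1)) = k := fun k hk ↦ by
    rw [← (hcoord _ (e.map_target (hmem k hk 1))).1, e.right_inv (hmem k hk 1)]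
  rw [hsource] at he hcoord
  refine ⟨U, fun k ↦ e.symm (k, 1), fun x ↦ (e x).2, ⟨hU, ?_, hsec, ?_, fun x hx ↦ ?_, ?_⟩, hk⟩
  · exact he'.comp (contMDiffOn_id.prodMk contMDiffOn_const) fun k hk ↦ hmem k hk 1
  · exact contMDiff_snd.comp_contMDiffOn he
  · have hσ : e.symm (p x, 1) ∈ p ⁻¹' U := by rw [Set.mem_preimage, hsec _ hx]; exact hx
    have hσ' : a (e x).2 (e.symm (p x, 1)) ∈ p ⁻¹' U := by rwa [Set.mem_preimage, h.proj_act]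
    refine e.injOn (hsource ▸ hσ') (hsource ▸ hx) (Prod.ext ?_ ?_)
    · rw [(hcoord _ hσ').1, (hcoord x hx).1, h.proj_act, hsec _ hx]
    · rw [(hcoord _ hσ).2, e.right_inv (hmem _ hx 1), mul_one]
  · exact fun g x hx ↦ (hcoord x hx).2 g

lemma hasSmoothLocalSections (h : IsPrincipalBundle IG IM IK a p) :
    HasSmoothLocalSections IM IK p := fun k ↦ by
  obtain ⟨U, σ, τ, hgauge, hk⟩ := h.exists_isLocalGauge k
  have hU : U ∈ 𝓝 k := hgauge.isOpen.mem_nhds hk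
  exact ⟨σ, hgauge.contMDiffOn_section.contMDiffAt hU, by
    filter_upwards [hU] with k' hk' using hgauge.proj_section k' hk'⟩

lemma exists_projected_vectorField [IsManifold IM 1 M] [IsManifold IK 1 K]
    (h : IsPrincipalBundle IG IM IK a p) {X : ∀ x : M, TangentSpace IM x}
    (hX : CMDiff ∞ (T% X)) (hXa : ∀ g x, mfderiv% (a g) x (X x) = X (a g x)) :
    ∃ Y : ∀ k : K, TangentSpace IK k, CMDiff ∞ (T% Y) ∧ ∀ x, mfderiv% p x (X x) = Y (p x) := by
  refine h.hasSmoothLocalSections.exists_projected_vectorField h.contMDiff hX fun x y hxy ↦ ?_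
  obtain ⟨g, rfl⟩ := (h.fiber_iff x y).1 hxy
  have htangent : tangentMap IM IM (a g) ⟨x, X x⟩ = ⟨a g x, X (a g x)⟩ :=
    congrArg (Bundle.TotalSpace.mk (a g x)) (hXa g x)
  rw [← htangent, ← tangentMap_comp_at _ ((h.contMDiff _).mdifferentiableAt (by decide))
    ((h.isSmoothAction.contMDiff_act g x).mdifferentiableAt (by decide)),
    show p ∘ a g = p from funext (h.proj_act g)]

/-- The map on the base of a principal bundle induced by an invariant map `F` on the total space;
in general, its value at `k` is the value of `F` at a chosen point over `k`. -/
def descend (h : IsPrincipalBundle IG IM IK a p) {α : Type*} (F : M → α) (k : K) : α :=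
  F (Function.surjInv h.surjective k)

lemma descend_apply (h : IsPrincipalBundle IG IM IK a p) {α : Type*} {F : M → α} {x : M}
    (hF : ∀ g, F (a g x) = F x) : h.descend F (p x) = F x := by
  obtain ⟨g, hg⟩ := (h.fiber_iff x _).1 (Function.surjInv_eq h.surjective (p x)).symm
  rw [descend, hg, hF]

lemma semiconj_descend (h : IsPrincipalBundle IG IM IK a p) {b : M → M}
    (hb : ∀ g, Function.Commute (a g) b) : Function.Semiconj p b (h.descend (p ∘ b)) := fun x ↦
  (h.descend_apply (F := p ∘ b) fun g ↦ by
    rw [Function.comp_apply, ← (hb g).eq, h.proj_act, Function.comp_apply]).symm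

variable {q : M → P} {φ : L → M → M} {φP : L → P → P}

lemma isSmoothAction_of_semiconj (hq : IsPrincipalBundle IG IM IP a q)
    (hφ : IsSmoothAction IL IM φ) (hφP : ∀ s, Function.Semiconj q (φ s) (φP s)) :
    IsSmoothAction IL IP φP where
  one_act := hq.surjective.forall.2 fun x ↦ by rw [← (hφP 1).eq, hφ.one_act]
  mul_act s t := hq.surjective.forall.2 fun x ↦ by
    rw [← (hφP t).eq, ← (hφP s).eq, ← (hφP _).eq, hφ.mul_act]
  contMDiff := hq.hasSmoothLocalSections.prodMap_id.contMDiff_of_comp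
    ((hq.contMDiff.comp hφ.contMDiff).congr fun z ↦ ((hφP z.1).eq z.2).symm)

lemma isLocalGauge_descend (hq : IsPrincipalBundle IG IM IP a q) (hφ : IsSmoothAction IL IM φ)
    (hφP : ∀ s, Function.Semiconj q (φ s) (φP s)) {p : P → K} (hp : ∀ s y, p (φP s y) = p y)
    {U : Set K} {σ : K → M} {τ : M → L × G}
    (hj : IsLocalGauge (IL.prod IG) IM IK (fun z x ↦ φ z.1 (a z.2 x)) (p ∘ q) U σ τ) :
    IsLocalGauge IL IP IK φP p U (q ∘ σ) (hq.descend fun x ↦ (τ x).1) := by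
  have hτa (g x) (hx : p (q x) ∈ U) : τ (a g x) = (1, g) * τ x := by
    simpa only [hφ.one_act] using hj.coord_act (1, g) x hx
  have hτφ (s x) (hx : p (q x) ∈ U) : τ (φ s x) = (s, 1) * τ x := by
    simpa only [hq.isSmoothAction.one_act] using hj.coord_act (s, 1) x hx
  have hdesc (x) (hx : p (q x) ∈ U) : hq.descend (fun x ↦ (τ x).1) (q x) = (τ x).1 :=
    hq.descend_apply fun g ↦ by rw [hτa g x hx, Prod.fst_mul, one_mul]
  have hpφ (s x) : p (q (φ s x)) = p (q x) := by rw [(hφP s).eq, hp]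
  refine ⟨hj.isOpen, hq.contMDiff.comp_contMDiffOn hj.contMDiffOn_section, hj.proj_section,
    hq.hasSmoothLocalSections.contMDiffOn_of_comp ?_, hq.surjective.forall.2 fun x hx ↦ ?_,
    fun s ↦ hq.surjective.forall.2 fun x hx ↦ ?_⟩
  · exact (contMDiff_fst.comp_contMDiffOn hj.contMDiffOn_coord).congr hdesc
  · rw [hdesc x hx, Function.comp_apply, ← hq.proj_act (τ x).2, ← (hφP _).eq]
    exact congrArg q (hj.coord_act_section x hx)
  · rw [← (hφP s).eq, hdesc _ ((hpφ s x).symm ▸ hx), hdesc x hx, hτφ s x hx, Prod.fst_mul]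

lemma reduction {r : M → K} (hq : IsPrincipalBundle IG IM IP a q) (hφ : IsSmoothAction IL IM φ)
    (hφP : ∀ s, Function.Semiconj q (φ s) (φP s))
    (hr : IsPrincipalBundle (IL.prod IG) IM IK (fun (z : L × G) x ↦ φ z.1 (a z.2 x)) r) :
    IsPrincipalBundle IL IP IK φP (hq.descend r) := by
  have hra (g x) : r (a g x) = r x := by simpa only [hφ.one_act] using hr.proj_act (1, g) x
  have hrφ (s x) : r (φ s x) = r x := by
    simpa only [hq.isSmoothAction.one_act] using hr.proj_act (s, 1) x
  have hdesc (x) : hq.descend r (q x) = r x := hq.descend_apply fun g ↦ hra g x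
  have hinv (s) : ∀ y, hq.descend r (φP s y) = hq.descend r y :=
    hq.surjective.forall.2 fun x ↦ by rw [← (hφP s).eq, hdesc, hdesc, hrφ]
  refine of_localGauges (hq.isSmoothAction_of_semiconj hφ hφP)
    (hq.hasSmoothLocalSections.contMDiff_of_comp (hr.contMDiff.congr hdesc)) hinv fun k ↦ ?_
  obtain ⟨U, σ, τ, hgauge, hk⟩ := hr.exists_isLocalGauge k
  rw [← show hq.descend r ∘ q = r from funext hdesc] at hgauge
  exact ⟨U, _, _, hq.isLocalGauge_descend hφ hφP hinv hgauge, hk⟩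

/-- The algebra homomorphism from the smooth functions on the base of a principal bundle to those
on the total space given by composition with the projection. -/
def pullback (h : IsPrincipalBundle IG IM IK a p) : C^∞⟮IK, K; ℝ⟯ →ₐ[ℝ] C^∞⟮IM, M; ℝ⟯ where
  toFun f := ⟨f ∘ p, f.contMDiff.comp h.contMDiff⟩
  map_one' := rfl
  map_mul' _ _ := rfl
  map_zero' := rfl
  map_add' _ _ := rfl
  commutes' _ := rfl

@[simp]
lemma pullback_apply (h : IsPrincipalBundle IG IM IK a p) (f : C^∞⟮IK, K; ℝ⟯) (x : M) :
    h.pullback f x = f (p x) :=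
  rfl

lemma pullback_injective (h : IsPrincipalBundle IG IM IK a p) :
    Function.Injective h.pullback := fun _ _ hfg ↦
  ContMDiffMap.ext (h.surjective.forall.2 fun x ↦ DFunLike.congr_fun hfg x)

lemma mem_range_pullback_iff (h : IsPrincipalBundle IG IM IK a p) {F : C^∞⟮IM, M; ℝ⟯} :
    F ∈ Set.range h.pullback ↔ ∀ g x, F (a g x) = F x := by
  constructor
  · rintro ⟨f, rfl⟩ g x
    rw [pullback_apply, pullback_apply, h.proj_act]
  · intro hF
    have hdesc (x) : h.descend F (p x) = F x := h.descend_apply fun g ↦ hF g x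
    exact ⟨⟨h.descend F, h.hasSmoothLocalSections.contMDiff_of_comp (F.contMDiff.congr hdesc)⟩,
      ContMDiffMap.ext hdesc⟩

end IsPrincipalBundle

namespace IsPrincipalAction

variable {M P : Type u} [TopologicalSpace M] [ChartedSpace HM M]
  [TopologicalSpace P] [ChartedSpace HP P] {a : G → M → M} {φ : L → M → M} {φP : L → P → P}

lemma isSmoothAction (h : IsPrincipalAction IG IM a) : IsSmoothAction IG IM a := by
  obtain ⟨_, _, _, _, _, _, _, _, hp⟩ := h
  exact hp.isSmoothAction

lemma reduction {q : M → P}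
    (h : IsPrincipalAction (IL.prod IG) IM (fun (z : L × G) x ↦ φ z.1 (a z.2 x)))
    (hq : IsPrincipalBundle IG IM IP a q) (hφ : IsSmoothAction IL IM φ)
    (hφP : ∀ s, Function.Semiconj q (φ s) (φP s)) : IsPrincipalAction IL IP φP := by
  obtain ⟨d, K, _, _, r, hK, hK₂, hK₃, hr⟩ := h
  exact ⟨d, K, _, _, _, hK, hK₂, hK₃, hq.reduction hφ hφP hr⟩

end IsPrincipalAction

end PrincipalBundles

section PoissonReduction

variable {n m : ℕ} {M P : Type*}
  [TopologicalSpace M] [ChartedSpace (EuclideanSpace ℝ (Fin n)) M]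
  [TopologicalSpace P] [ChartedSpace (EuclideanSpace ℝ (Fin m)) P]

namespace PoissonBracket

section Conformal

variable {B : PoissonBracket n M} {a : M → M} {c : ℝ}

lemma antisymm (B : PoissonBracket n M) (f g : C^∞⟮𝓡 n, M; ℝ⟯) :
    B.bracket f g = -B.bracket g f := by
  have h := B.self_eq_zero (f + g)
  simp only [map_add, LinearMap.add_apply, B.self_eq_zero, zero_add, add_zero] at h
  exact eq_neg_of_add_eq_zero_right h

/-- The map `a` rescales the Poisson bracket by `c`, that is `{F ∘ a, F' ∘ a} = c {F, F'} ∘ a`;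
for `c = 1` it is a Poisson map. The functions `F ∘ a` and `F' ∘ a` are written as smooth functions
`F₁` and `F₁'`. -/
def IsConformal (B : PoissonBracket n M) (a : M → M) (c : ℝ) : Prop :=
  ∀ F F' F₁ F₁' : C^∞⟮𝓡 n, M; ℝ⟯, (∀ x, F₁ x = F (a x)) → (∀ x, F₁' x = F' (a x)) →
    ∀ x, B.bracket F₁ F₁' x = c * B.bracket F F' (a x)

lemma IsConformal.bracket_of_homogeneous (hB : B.IsConformal a c) (hc : c ≠ 0)
    {F F' F₁' : C^∞⟮𝓡 n, M; ℝ⟯} (hF : ∀ x, F (a x) = c * F x) (hF' : ∀ x, F₁' x = F' (a x))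
    (x : M) : B.bracket F F' (a x) = B.bracket F F₁' x := by
  have h := hB F F' (c • F) F₁' (fun x ↦ (hF x).symm) hF' x
  rw [map_smul, LinearMap.smul_apply] at h
  exact (mul_left_cancel₀ hc h).symm

lemma isHomogeneous_bracket {Λ : OpenSubgroup ℝˣ} {φ : Λ → M → M}
    (hB : ∀ s, B.IsConformal (φ s) (scal s)) {F F' : C^∞⟮𝓡 n, M; ℝ⟯}
    (hF : IsHomogeneous φ F) (hF' : IsHomogeneous φ F') : IsHomogeneous φ (B.bracket F F') := by
  intro s x
  rw [(hB s).bracket_of_homogeneous (F₁' := scal s • F') (scal_ne_zero s) (hF s)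
    (fun x ↦ (hF' s x).symm), map_smul]
  rfl

end Conformal

section HamiltonianVectorFields

variable {B : PoissonBracket n M} {F : C^∞⟮𝓡 n, M; ℝ⟯} {X : ∀ x : M, TangentSpace (𝓡 n) x}

/-- The vector field `X` is Hamiltonian for the function `F`, that is `X(F') = {F, F'}` for every
smooth function `F'`. -/
def IsHamiltonianVF (B : PoissonBracket n M) (F : C^∞⟮𝓡 n, M; ℝ⟯)
    (X : ∀ x : M, TangentSpace (𝓡 n) x) : Prop :=
  ∀ F' : C^∞⟮𝓡 n, M; ℝ⟯, vfDeriv X F' = B.bracket F F'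

variable [IsManifold (𝓡 n) ∞ M] [T2Space M]

lemma IsHamiltonianVF.mfderiv_eq (hX : B.IsHamiltonianVF F X) {a : M → M} {c : ℝ}
    (hB : B.IsConformal a c) (hc : c ≠ 0) (ha : ContMDiff (𝓡 n) (𝓡 n) ∞ a)
    (hF : ∀ x, F (a x) = c * F x) (x : M) : mfderiv (𝓡 n) (𝓡 n) a x (X x) = X (a x) := by
  refine tangentSpace_ext fun F' ↦ ?_
  rw [← vfDeriv_comp X F'.mdifferentiableAt ((ha x).mdifferentiableAt (by decide))]
  calc vfDeriv X (fun y ↦ F' (a y)) x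
      = B.bracket F ⟨F' ∘ a, F'.contMDiff.comp ha⟩ x := congrFun (hX ⟨_, F'.contMDiff.comp ha⟩) x
    _ = B.bracket F F' (a x) := (hB.bracket_of_homogeneous hc hF (fun _ ↦ rfl) x).symm
    _ = vfDeriv X F' (a x) := (congrFun (hX F') (a x)).symm

variable {EG HG G : Type*} [NormedAddCommGroup EG] [NormedSpace ℝ EG] [TopologicalSpace HG]
  [Group G] [TopologicalSpace G] [ChartedSpace HG G] {IG : ModelWithCorners ℝ EG HG}
  {a : G → M → M} {p : M → P} [IsManifold (𝓡 m) ∞ P]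

lemma IsHamiltonianVF.exists_projected (hX : B.IsHamiltonianVF F X) (hXs : IsSmoothVectorField X)
    (hp : IsPrincipalBundle IG (𝓡 n) (𝓡 m) a p) {c : G → ℝ} (hc : ∀ g, c g ≠ 0)
    (hB : ∀ g, B.IsConformal (a g) (c g)) (hF : ∀ g x, F (a g x) = c g * F x) :
    ∃ Y : ∀ y : P, TangentSpace (𝓡 m) y, IsSmoothVectorField Y ∧
      (∀ x, mfderiv (𝓡 n) (𝓡 m) p x (X x) = Y (p x)) ∧
      ∀ (f : C^∞⟮𝓡 m, P; ℝ⟯) x, vfDeriv Y f (p x) = B.bracket F (hp.pullback f) x := by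
  have : IsManifold (𝓡 n) 1 M := .of_le (n := ∞) (by decide)
  have : IsManifold (𝓡 m) 1 P := .of_le (n := ∞) (by decide)
  obtain ⟨Y, hYs, hXY⟩ := hp.exists_projected_vectorField hXs fun g ↦
    hX.mfderiv_eq (hB g) (hc g) (hp.isSmoothAction.contMDiff_act g) (hF g)
  refine ⟨Y, hYs, hXY, fun f x ↦ ?_⟩
  rw [← congrFun (hX _) x, vfDeriv, ← hXY x]
  exact (vfDeriv_comp X f.mdifferentiableAt ((hp.contMDiff x).mdifferentiableAt (by decide))).symm

end HamiltonianVectorFields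

section Reduction

variable {EG HG G : Type*} [NormedAddCommGroup EG] [NormedSpace ℝ EG] [TopologicalSpace HG]
  [Group G] [TopologicalSpace G] [ChartedSpace HG G] {IG : ModelWithCorners ℝ EG HG}
  {Φ : G → M → M} {q : M → P}

lemma bracket_pullback_mem_range {B : PoissonBracket n M}
    (hq : IsPrincipalBundle IG (𝓡 n) (𝓡 m) Φ q) (hB : ∀ g, B.IsConformal (Φ g) 1)
    (f f' : C^∞⟮𝓡 m, P; ℝ⟯) :
    B.bracket (hq.pullback f) (hq.pullback f') ∈ Set.range hq.pullback :=
  hq.mem_range_pullback_iff.2 fun g x ↦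
    (hB g).bracket_of_homogeneous one_ne_zero
      (fun x ↦ by rw [hq.pullback_apply, hq.proj_act, one_mul, hq.pullback_apply])
      (fun x ↦ by rw [hq.pullback_apply, hq.pullback_apply, hq.proj_act]) x

/-- Poisson reduction: the Poisson bracket on the base of a principal bundle whose group acts by
Poisson maps, for which the projection is a Poisson map. -/
def reduce (B : PoissonBracket n M) (hq : IsPrincipalBundle IG (𝓡 n) (𝓡 m) Φ q)
    (hB : ∀ g, B.IsConformal (Φ g) 1) : PoissonBracket m P :=
  let i : C^∞⟮𝓡 m, P; ℝ⟯ →ₗ[ℝ] C^∞⟮𝓡 n, M; ℝ⟯ := hq.pullback.toLinearMap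
  have hi : Function.Injective i := hq.pullback_injective
  let b := LinearMap.restrictScalarsRange₂ i i i hi B.bracket (bracket_pullback_mem_range hq hB)
  have hb (f f') : i (b f f') = B.bracket (i f) (i f') :=
    LinearMap.restrictScalarsRange₂_apply i i i hi B.bracket _ f f'
  have hmul (f f') : i (f * f') = i f * i f' := map_mul hq.pullback f f'
  { bracket := b
    self_eq_zero f := hi <| by rw [hb, B.self_eq_zero, map_zero]
    jacobi f₁ f₂ f₃ := hi <| by simp only [map_add, hb, B.jacobi, map_zero]
    leibniz f f₁ f₂ := hi <| by simp only [map_add, hmul, hb, B.leibniz] }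

lemma reduce_apply (B : PoissonBracket n M) (hq : IsPrincipalBundle IG (𝓡 n) (𝓡 m) Φ q)
    (hB : ∀ g, B.IsConformal (Φ g) 1) (f f' : C^∞⟮𝓡 m, P; ℝ⟯) (x : M) :
    (B.reduce hq hB).bracket f f' (q x) = B.bracket (hq.pullback f) (hq.pullback f') x :=
  DFunLike.congr_fun (LinearMap.restrictScalarsRange₂_apply hq.pullback.toLinearMap
    hq.pullback.toLinearMap hq.pullback.toLinearMap hq.pullback_injective B.bracket
    (bracket_pullback_mem_range hq hB) f f') x

variable {B : PoissonBracket n M}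

lemma IsConformal.reduce (hq : IsPrincipalBundle IG (𝓡 n) (𝓡 m) Φ q)
    (hΦ : ∀ g, B.IsConformal (Φ g) 1) {a : M → M} {b : P → P} {c : ℝ} (hB : B.IsConformal a c)
    (hab : Function.Semiconj q a b) : (B.reduce hq hΦ).IsConformal b c := by
  intro F F' F₁ F₁' hF hF'
  refine hq.surjective.forall.2 fun x ↦ ?_
  rw [← hab.eq, reduce_apply, reduce_apply]
  exact hB _ _ _ _ (fun x ↦ by simp only [hq.pullback_apply, hF, hab.eq])
    (fun x ↦ by simp only [hq.pullback_apply, hF', hab.eq]) x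

lemma IsHamiltonianVF.exists_reduce [IsManifold (𝓡 n) ∞ M] [T2Space M] [IsManifold (𝓡 m) ∞ P]
    (hq : IsPrincipalBundle IG (𝓡 n) (𝓡 m) Φ q) (hΦ : ∀ g, B.IsConformal (Φ g) 1)
    {F : C^∞⟮𝓡 m, P; ℝ⟯} {X : ∀ x : M, TangentSpace (𝓡 n) x}
    (hX : B.IsHamiltonianVF (hq.pullback F) X) (hXs : IsSmoothVectorField X) :
    ∃ Y : ∀ y : P, TangentSpace (𝓡 m) y, IsSmoothVectorField Y ∧
      (∀ x, mfderiv (𝓡 n) (𝓡 m) q x (X x) = Y (q x)) ∧ (B.reduce hq hΦ).IsHamiltonianVF F Y := by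
  obtain ⟨Y, hYs, hXY, hY⟩ := hX.exists_projected hXs hq (fun _ ↦ one_ne_zero) hΦ fun g x ↦ by
    rw [hq.pullback_apply, hq.proj_act, one_mul, hq.pullback_apply]
  exact ⟨Y, hYs, hXY, fun f ↦ funext <| hq.surjective.forall.2 fun x ↦ by
    rw [hY, reduce_apply]⟩

end Reduction

end PoissonBracket

namespace SymplecticForm

variable [IsManifold (𝓡 n) ∞ M] (Ω : SymplecticForm n M)

lemma isHamiltonianVF_hamiltonianVF (f : C^∞⟮𝓡 n, M; ℝ⟯) :
    Ω.poissonBracket.IsHamiltonianVF f (Ω.hamiltonianVF f) := fun g ↦ by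
  ext x
  rw [poissonBracket_apply, poisson_eq_vfDeriv]

variable {Ω}

lemma PullbackEq.isConformal_poissonBracket {a : M → M} {c : ℝ} (h : Ω.PullbackEq a c)
    (hc : c ≠ 0) (ha : ContMDiff (𝓡 n) (𝓡 n) ∞ a) : Ω.poissonBracket.IsConformal a c := by
  intro f g f₁ g₁ hf hg x
  rw [poissonBracket_apply, poissonBracket_apply, show f₁ = f ∘ a from funext hf,
    show g₁ = g ∘ a from funext hg]
  exact h.poisson_comp hc f.mdifferentiableAt g.mdifferentiableAt
    ((ha x).mdifferentiableAt (by decide))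

end SymplecticForm

end PoissonReduction

section KirillovBrackets

variable {m d : ℕ} {M K : Type*} {Λ : OpenSubgroup ℝˣ}
  [TopologicalSpace M] [ChartedSpace (EuclideanSpace ℝ (Fin m)) M]
  [TopologicalSpace K] [ChartedSpace (EuclideanSpace ℝ (Fin d)) K]
  {φ : Λ → M → M} {p : M → K} {hp : IsPrincipalBundle 𝓘(ℝ, ℝ) (𝓡 m) (𝓡 d) φ p}

lemma contMDiff_scal : ContMDiff 𝓘(ℝ, ℝ) 𝓘(ℝ, ℝ) ∞ (scal : Λ → ℝ) :=
  (Units.contMDiff_val (R := ℝ)).comp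
    (contMDiff_subtype_val (U := (Λ : TopologicalSpace.Opens ℝˣ)))

lemma LineFiber.dual_ext {x : M} {α β : Module.Dual ℝ (LineFiber hp (p x))}
    (h : α (LineFiber.mk hp x 1) = β (LineFiber.mk hp x 1)) : α = β := by
  ext l
  obtain ⟨t, rfl⟩ := (LineFiber.mkAt_bijective hp (x := x) rfl).surjective l
  change α (LineFiber.mk hp x t) = β (LineFiber.mk hp x t)
  rw [← mul_one t, LineFiber.mk_smul, map_smul, map_smul, h]

lemma LineFiber.dual_mk_act (α : ∀ k, Module.Dual ℝ (LineFiber hp k)) (s : Λ) (x : M) :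
    α (p (φ s x)) (LineFiber.mk hp (φ s x) 1) = scal s * α (p x) (LineFiber.mk hp x 1) := by
  have hcongr {l l' : LineTotal hp} (hl : l = l') : α l.proj ⟨l, rfl⟩ = α l'.proj ⟨l', rfl⟩ := by
    rw [hl]
  have hmk : LineTotal.mk hp (φ s x) 1 = LineTotal.mk hp x (scal s) :=
    ((LineTotal.mk_eq_iff hp).2 ⟨s, rfl, (div_self (scal_ne_zero s)).symm⟩).symm
  calc α (p (φ s x)) (LineFiber.mk hp (φ s x) 1)
      = α (p x) (LineFiber.mk hp x (scal s * 1)) := by rw [mul_one]; exact hcongr hmk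
    _ = scal s * α (p x) (LineFiber.mk hp x 1) := by
      rw [LineFiber.mk_smul, map_smul, smul_eq_mul]

lemma IsSmoothDualSection.contMDiff {h : ∀ k, Module.Dual ℝ (LineFiber hp k)}
    (hh : IsSmoothDualSection hp h) :
    ContMDiff (𝓡 m) 𝓘(ℝ, ℝ) ∞ fun x ↦ h (p x) (LineFiber.mk hp x 1) := by
  intro x
  obtain ⟨U, σ, τ, hgauge, hx⟩ := hp.exists_isLocalGauge (p x)
  have hloc : ContMDiffOn (𝓡 m) 𝓘(ℝ, ℝ) ∞
      (fun x ↦ scal (τ x) * h (p (σ (p x))) (LineFiber.mk hp (σ (p x)) 1)) (p ⁻¹' U) :=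
    (contMDiff_scal.comp_contMDiffOn hgauge.contMDiffOn_coord).mul
      ((hh U σ hgauge.isOpen hgauge.contMDiffOn_section hgauge.proj_section).comp
        hp.contMDiff.contMDiffOn fun _ hx ↦ hx)
  refine (hloc.congr fun x hx ↦ ?_).contMDiffAt
    ((hgauge.isOpen.preimage hp.contMDiff.continuous).mem_nhds hx)
  rw [← LineFiber.dual_mk_act, hgauge.coord_act_section x hx]

variable (hp) in
/-- The homogeneous function `x ↦ h(p x)[x, 1]` of a section `h` of `L^*`; this is the inverse of
`sectionOf`. -/
def homogeneousOf : dualSections hp →ₗ[ℝ] C^∞⟮𝓡 m, M; ℝ⟯ where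
  toFun h := ⟨fun x ↦ h.1 (p x) (LineFiber.mk hp x 1), IsSmoothDualSection.contMDiff h.2⟩
  map_add' _ _ := rfl
  map_smul' _ _ := rfl

lemma homogeneousOf_apply (h : dualSections hp) (x : M) :
    homogeneousOf hp h x = h.1 (p x) (LineFiber.mk hp x 1) :=
  rfl

lemma isHomogeneous_homogeneousOf (h : dualSections hp) : IsHomogeneous φ (homogeneousOf hp h) :=
  LineFiber.dual_mk_act h.1

lemma homogeneousOf_sectionOf (F : C^∞⟮𝓡 m, M; ℝ⟯) (hF : IsHomogeneous φ F) :
    homogeneousOf hp (sectionOf hp F hF) = F := by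
  ext x
  rw [homogeneousOf_apply, sectionOf_apply, one_mul]

lemma homogeneousOf_injective : Function.Injective (homogeneousOf hp) := fun _ _ hh ↦
  Subtype.ext <| funext <| hp.surjective.forall.2 fun x ↦
    LineFiber.dual_ext (DFunLike.congr_fun hh x)

lemma homogeneousOf_neg (h : dualSections hp) : homogeneousOf hp (-h) = -homogeneousOf hp h :=
  rfl

lemma homogeneousOf_funSmul (f : C^∞⟮𝓡 d, K; ℝ⟯) (h : dualSections hp) :
    homogeneousOf hp (funSmul hp f h) = hp.pullback f * homogeneousOf hp h :=
  rfl

namespace PoissonBracket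

variable (B : PoissonBracket m M) (hB : ∀ s, B.IsConformal (φ s) (scal s))

variable (hp) in
/-- The bracket of sections of `L^*` for which `h ↦ -homogeneousOf h` is a morphism to the Poisson
algebra of `M`. -/
def dualBracket : dualSections hp →ₗ[ℝ] dualSections hp →ₗ[ℝ] dualSections hp :=
  LinearMap.restrictScalarsRange₂ (homogeneousOf hp) (homogeneousOf hp) (homogeneousOf hp)
    homogeneousOf_injective (-B.bracket) fun h h' ↦ LinearMap.mem_range.1 <| neg_mem
      ⟨_, homogeneousOf_sectionOf _ <| isHomogeneous_bracket hB (isHomogeneous_homogeneousOf h)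
        (isHomogeneous_homogeneousOf h')⟩

lemma homogeneousOf_dualBracket (h h' : dualSections hp) :
    homogeneousOf hp (B.dualBracket hp hB h h') =
      -B.bracket (homogeneousOf hp h) (homogeneousOf hp h') :=
  LinearMap.restrictScalarsRange₂_apply _ _ _ _ _ _ h h'

lemma dualBracket_sectionOf {F F' : C^∞⟮𝓡 m, M; ℝ⟯} (hF : IsHomogeneous φ F)
    (hF' : IsHomogeneous φ F') :
    B.dualBracket hp hB (sectionOf hp F hF) (sectionOf hp F' hF') =
      -sectionOf hp (B.bracket F F') (isHomogeneous_bracket hB hF hF') := by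
  apply homogeneousOf_injective
  rw [homogeneousOf_dualBracket, homogeneousOf_neg]
  simp only [homogeneousOf_sectionOf]

lemma isSymbol_dualBracket {h₂ : dualSections hp} {X : ∀ k : K, TangentSpace (𝓡 d) k}
    (hX : ∀ (f : C^∞⟮𝓡 d, K; ℝ⟯) x,
      vfDeriv X f (p x) = B.bracket (homogeneousOf hp h₂) (hp.pullback f) x) :
    IsSymbol hp (fun h₁ ↦ B.dualBracket hp hB h₁ h₂) X := by
  intro f h₁
  refine hp.surjective.forall.2 fun x ↦ LineFiber.dual_ext ?_
  have hleibniz := DFunLike.congr_fun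
    (B.leibniz (hp.pullback f) (homogeneousOf hp h₁) (homogeneousOf hp h₂)) x
  rw [B.antisymm (hp.pullback f)] at hleibniz
  rw [LinearMap.add_apply, LinearMap.smul_apply, LinearMap.smul_apply]
  simp only [← homogeneousOf_apply, homogeneousOf_dualBracket, homogeneousOf_funSmul, hX,
    smul_eq_mul]
  change -(B.bracket (hp.pullback f * _) _ x) = f (p x) * -_ + _
  rw [hleibniz]
  change -(f (p x) * _ + -_ * _) = _
  ring

lemma IsHamiltonianVF.exists_projected_isSymbol [IsManifold (𝓡 m) ∞ M] [T2Space M]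
    [IsManifold (𝓡 d) ∞ K] {B : PoissonBracket m M} (hB : ∀ s, B.IsConformal (φ s) (scal s))
    {h : dualSections hp} {X : ∀ x : M, TangentSpace (𝓡 m) x}
    (hX : B.IsHamiltonianVF (homogeneousOf hp h) X) (hXs : IsSmoothVectorField X) :
    ∃ Y : ∀ k : K, TangentSpace (𝓡 d) k, IsSmoothVectorField Y ∧
      (∀ x, mfderiv (𝓡 m) (𝓡 d) p x (X x) = Y (p x)) ∧
      IsSymbol hp (fun h' ↦ B.dualBracket hp hB h' h) Y := by
  obtain ⟨Y, hYs, hXY, hY⟩ :=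
    hX.exists_projected hXs hp scal_ne_zero hB (isHomogeneous_homogeneousOf h)
  exact ⟨Y, hYs, hXY, B.isSymbol_dualBracket hB hY⟩

variable (hp) in
/-- The Kirillov bracket on `Γ(L^*)` of a homogeneous Poisson bracket on the total space, all of
whose homogeneous functions have smooth Hamiltonian vector fields. -/
def kirillovBracket [IsManifold (𝓡 m) ∞ M] [T2Space M] [IsManifold (𝓡 d) ∞ K]
    (hX : ∀ F : C^∞⟮𝓡 m, M; ℝ⟯, ∃ X, IsSmoothVectorField X ∧ B.IsHamiltonianVF F X) :
    KirillovBracket hp where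
  bracket := B.dualBracket hp hB
  self_eq_zero h := homogeneousOf_injective <| by
    rw [homogeneousOf_dualBracket, B.self_eq_zero, neg_zero, map_zero]
  jacobi h₁ h₂ h₃ := homogeneousOf_injective <| by
    simp only [map_add, homogeneousOf_dualBracket, map_neg, neg_neg, B.jacobi, map_zero]
  derivation h := by
    obtain ⟨X, hXs, hX⟩ := hX (homogeneousOf hp h)
    obtain ⟨Y, hYs, -, hY⟩ := hX.exists_projected_isSymbol hB hXs
    exact ⟨Y, hYs, hY⟩

end PoissonBracket

section SymbolUniqueness

variable [IsManifold (𝓡 d) ∞ K] [T2Space K]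

variable (hp) in
lemma exists_dualSection_ne_zero (k : K) : ∃ h : dualSections hp, h.1 k ≠ 0 := by
  obtain ⟨U, σ, τ, hgauge, hk⟩ := hp.exists_isLocalGauge k
  obtain ⟨ρ, -, hρ⟩ := (SmoothBumpFunction.nhds_basis_tsupport (I := 𝓡 d) k).mem_iff.1
    (hgauge.isOpen.mem_nhds hk)
  have hsmooth : ContMDiff (𝓡 m) 𝓘(ℝ, ℝ) ∞ fun x ↦ ρ (p x) * scal (τ x) := by
    refine contMDiff_of_tsupport fun x hx ↦ ?_
    have hxU : p x ∈ U := hρ <| tsupport_comp_subset_preimage ρ hp.contMDiff.continuous <|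
      tsupport_mul_subset_left hx
    exact ((ρ.contMDiff.comp hp.contMDiff) x).mul <| (contMDiff_scal _).comp x <|
      hgauge.contMDiffOn_coord.contMDiffAt <|
        (hgauge.isOpen.preimage hp.contMDiff.continuous).mem_nhds hxU
  have hhom : IsHomogeneous φ fun x ↦ ρ (p x) * scal (τ x) := fun s x ↦ by
    simp only [hp.proj_act]
    by_cases hx : p x ∈ U
    · rw [hgauge.coord_act s x hx, scal_mul, mul_left_comm]
    · rw [image_eq_zero_of_notMem_tsupport fun hx' ↦ hx (hρ hx'), zero_mul, zero_mul, mul_zero]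
  obtain ⟨x, rfl⟩ := hp.surjective k
  refine ⟨sectionOf hp ⟨_, hsmooth⟩ hhom, fun hzero ↦ scal_ne_zero (τ x) ?_⟩
  have hx : 1 * (ρ (p x) * scal (τ x)) = 0 :=
    (sectionOf_apply hp ⟨_, hsmooth⟩ hhom x 1).symm.trans (DFunLike.congr_fun hzero _)
  rwa [ρ.eq_one, one_mul, one_mul] at hx

lemma IsSymbol.unique {D : dualSections hp → dualSections hp} {X Y : ∀ k : K, TangentSpace (𝓡 d) k}
    (hX : IsSymbol hp D X) (hY : IsSymbol hp D Y) : X = Y := by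
  funext k
  obtain ⟨h, hh⟩ := exists_dualSection_ne_zero hp k
  exact tangentSpace_ext fun f ↦
    smul_left_injective ℝ hh (add_left_cancel ((hX f h k).symm.trans (hY f h k)))

end SymbolUniqueness

end KirillovBrackets

end

theorem mainTheorem3 {n g m : ℕ} {S P : Type u} {G : Type*}
    -- the symplectic Hamiltonian system
    [TopologicalSpace S] [ChartedSpace (EuclideanSpace ℝ (Fin n)) S] [IsManifold (𝓡 n) ∞ S]
    [T2Space S] [SecondCountableTopology S]
    (Ω : SymplecticForm n S) (H : C^∞⟮𝓡 n, S; ℝ⟯)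
    -- the scaling group and the scaling symmetry
    (Λ : OpenSubgroup ℝˣ) (hΛ : (Λ : Subgroup ℝˣ) = ⊤ ∨ (Λ : Subgroup ℝˣ) = Units.posSubgroup ℝ)
    (φ : Λ → S → S) (hφ : IsScalingSymmetry Ω H φ)
    -- the Lie group, the orbit manifold and the symplectic symmetry
    [Group G] [TopologicalSpace G] [ChartedSpace (EuclideanSpace ℝ (Fin g)) G]
    [LieGroup (𝓡 g) ∞ G]
    [TopologicalSpace P] [ChartedSpace (EuclideanSpace ℝ (Fin m)) P] [IsManifold (𝓡 m) ∞ P]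
    [T2Space P] [SecondCountableTopology P]
    (Φ : G → S → S) (q : S → P) (hΦ : IsSymplecticSymmetry Ω H g m Φ q)
    -- compatibility: the actions commute, and together they form a principal action
    (hcomm : ∀ b s x, Φ b (φ s x) = φ s (Φ b x))
    (hjoint : IsPrincipalAction (𝓘(ℝ, ℝ).prod (𝓡 g)) (𝓡 n)
      (fun (z : Λ × G) x => φ z.1 (Φ z.2 x))) :
    -- the reduced Poisson bracket, the reduced Hamiltonian and the reduced action on `P`
    ∃ (B : PoissonBracket m P) (HG : C^∞⟮𝓡 m, P; ℝ⟯) (φP : Λ → P → P),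
      (∀ (f₁ f₂ : C^∞⟮𝓡 m, P; ℝ⟯) (x : S),
        B.bracket f₁ f₂ (q x) = Ω.poisson (fun y => f₁ (q y)) (fun y => f₂ (q y)) x) ∧
      (∀ x, HG (q x) = H x) ∧
      (∀ s x, φP s (q x) = q (φ s x)) ∧
      B.IsScalingSymmetry HG φP ∧
      -- for the orbit manifold `K` of the reduced action and its associated line bundle
      ∀ (d : ℕ) (K : Type u) [TopologicalSpace K] [ChartedSpace (EuclideanSpace ℝ (Fin d)) K]
        [IsManifold (𝓡 d) ∞ K] [T2Space K] [SecondCountableTopology K]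
        (p : P → K) (hp : IsPrincipalBundle 𝓘(ℝ, ℝ) (𝓡 m) (𝓡 d) φP p),
        ∃ (hHG : IsHomogeneous φP HG) (kir : KirillovBracket hp),
          (∀ (H₁ H₂ : C^∞⟮𝓡 m, P; ℝ⟯) (h₁ : IsHomogeneous φP H₁) (h₂ : IsHomogeneous φP H₂),
            ∃ h₁₂ : IsHomogeneous φP (B.bracket H₁ H₂),
              kir.bracket (sectionOf hp H₁ h₁) (sectionOf hp H₂ h₂) =
                -sectionOf hp (B.bracket H₁ H₂) h₁₂) ∧
          ∃ X : ∀ k : K, TangentSpace (𝓡 d) k,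
            IsSmoothVectorField X ∧
            IsSymbol hp (fun h => kir.bracket h (sectionOf hp HG hHG)) X ∧
            (∀ Y : ∀ k : K, TangentSpace (𝓡 d) k,
              IsSymbol hp (fun h => kir.bracket h (sectionOf hp HG hHG)) Y → Y = X) ∧
            ∀ x : S, mfderiv (𝓡 n) (𝓡 d) (fun y => p (q y)) x (Ω.hamiltonianVF H x) = X (p (q x)) := by
  have hq := hΦ.principal
  have hφa := hφ.principal.isSmoothAction
  have hΦc (b) : Ω.poissonBracket.IsConformal (Φ b) 1 :=
    (hΦ.pullback b).isConformal_poissonBracket one_ne_zero (hq.isSmoothAction.contMDiff_act b)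
  let B := Ω.poissonBracket.reduce hq hΦc
  obtain ⟨HG, hHG⟩ := hq.mem_range_pullback_iff.2 hΦ.invariant
  let φP (s : Λ) := hq.descend (q ∘ φ s)
  have hφP (s) : Function.Semiconj q (φ s) (φP s) := hq.semiconj_descend fun b ↦ hcomm b s
  have hB (s) : B.IsConformal (φP s) (scal s) := .reduce hq hΦc
    ((hφ.pullback s).isConformal_poissonBracket (scal_ne_zero s) (hφa.contMDiff_act s)) (hφP s)
  have hHGφ : IsHomogeneous φP HG := fun s ↦ hq.surjective.forall.2 fun x ↦ by
    rw [← hφP s, ← hq.pullback_apply, ← hq.pullback_apply, hHG, hφ.homogeneous]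
  have hham (F) := (Ω.isHamiltonianVF_hamiltonianVF (hq.pullback F)).exists_reduce hq hΦc
    (Ω.isSmoothVectorField_hamiltonianVF (hq.pullback F).contMDiff)
  refine ⟨B, HG, φP,
    fun f₁ f₂ x ↦ (Ω.poissonBracket.reduce_apply hq hΦc f₁ f₂ x).trans (Ω.poissonBracket_apply ..),
    DFunLike.congr_fun hHG, fun s x ↦ (hφP s x).symm,
    ⟨hjoint.reduction hq hφa hφP, hB, hHGφ⟩, fun d K _ _ _ _ _ p hp ↦ ?_⟩
  obtain ⟨X, hXs, hqX, hX⟩ := hham HG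
  rw [← homogeneousOf_sectionOf (hp := hp) HG hHGφ] at hX
  obtain ⟨Y, hYs, hpY, hY⟩ := hX.exists_projected_isSymbol hB hXs
  refine ⟨hHGφ, B.kirillovBracket hp hB fun F ↦ (hham F).imp fun _ h ↦ ⟨h.1, h.2.2⟩,
    fun _ _ h₁ h₂ ↦ ⟨_, B.dualBracket_sectionOf hB h₁ h₂⟩, Y, hYs, hY,
    fun _ hY' ↦ hY'.unique hY, fun x ↦ ?_⟩
  rw [← hpY, ← hqX, hHG]
  exact mfderiv_comp_apply x ((hp.contMDiff _).mdifferentiableAt (by decide))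
    ((hq.contMDiff x).mdifferentiableAt (by decide)) _
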